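/- Let $\omega,c\in\mathbb R$ with $c/\omega>0$, let $l\ge 0$ be an integer, and let $u(x,t)$ be a real classical solution for $t\ge0$ of the Camassa–Holm equation $u_t-u_{txx}+2\omega u_x+3uu_x=2u_xu_{xx}+uu_{xxx}$ with momentum $m=u-u_{xx}$ such that $u\to c$ as $x\to-\infty$, $u\to0$ as $x\to+\infty$, $\frac{m+\omega}{\omega}>0$, and, for every $T\ge0$, $\int_{\mathbb R}(1+|x|)^{l+1}\big(|m-cH(-x)|+|m_x|+|m_{xx}|\big)\,dx$ is bounded over $0\le t\le T$ ($H$ is the Heaviside function). Put $s=\sqrt{(c+\omega)/\omega}$, $$y=x-\int_x^{\infty}\Big(\sqrt{\tfrac{m+\omega}{\omega}}-1\Big)dr,\qquad \wp=x(s-1)-cst+\int_{-\infty}^x\Big(\sqrt{\tfrac{m+\omega}{\omega}}-s\Big)dr+\int_x^{\infty}\Big(\sqrt{\tfrac{m+\omega}{\omega}}-1\Big)dr,$$ $\lambda=k^2+\frac14=z^2+\frac{\omega}{4(c+\omega)}$, where $z=z(k)=\sqrt{k^2+\frac{c}{4(c+\omega)}}$ is cut along the segment between its two branch points, with $z\sim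 k$ at infinity, and $k(z)$ is its inverse on $\operatorname{Im} z\ne0$. The Jost solutions $\varphi_\pm(x,t;k)$ solve $\frac{\omega}{m+\omega}(-\varphi_{xx}+\frac14\varphi)=\lambda\varphi$ with $e^{-ikx+\frac{i\omega kt}{2\lambda}}\varphi_+\to1$ as $x\to+\infty$ ($\operatorname{Im}k>0$) and $s^{1/2}e^{izs(x-(c+\frac{\omega}{2\lambda})t)}\varphi_-\to1$ as $x\to-\infty$ ($\operatorname{Im}z(k)>0$). Let $W=\varphi_-\varphi_{+,x}-\varphi_+\varphi_{-,x}$, $a_+=W/(2ik)$, $a_-=W/(2iz)$, $g=ky-\frac{2\omega kt}{4k^2+1}$, $\widetilde g=z(y+\wp)-\frac{2\omega s\,zt}{4z^2+\omega/(c+\omega)}$, and $$V_r=\Big(\tfrac{m+\omega}{\omega}\Big)^{1/4}\Big(\tfrac{1}{a_+}\varphi_-e^{ig},\ \varphi_+e^{-ig}\Big)\ (\operatorname{Im}z(k)>0),$$ $$V_l=\Big(\tfrac{m+\omega}{\omega}\Big)^{1/4}\Big(\tfrac{1}{a_-}\varphi_+e^{-i\widetilde g},\ \varphi_-e^{i\widetilde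 g}\Big)\Big|_{k=k(z)}\ (\operatorname{Im}z>0),$$ continued to the other half-planes as follows: for $\operatorname{Im}z(k)<0$, $V_r(k)=\big(\overline{V_{r,2}(\bar k)},\overline{V_{r,1}(\bar k)}\big)$, and for $\operatorname{Im}z<0$, $V_l(z)=\big(\overline{V_{l,2}(\bar z)},\overline{V_{l,1}(\bar z)}\big)$. At points with $\lambda=0$ values are taken by continuity. Then for all $x\in\mathbb R$, $t\ge0$, with $z_0=\frac i2\sqrt{\frac{\omega}{c+\omega}}$: (1) $V_r$ has a limit at $k=\frac i2$ with nonzero second component, and $$\frac{V_{r,1}(x,t;\frac i2)}{V_{r,2}(x,t;\frac i2)}=e^{x-y},\qquad V_{r,1}V_{r,2}=\sqrt{\tfrac{m+\omega}{\omega}}\Big(1+\tfrac{2i}{\omega}u(x,t)\big(k-\tfrac i2\big)+O\big((k-\tfrac i2)^2\big)\Big),\quad k\to\tfrac i2 .$$ (2) $V_l$ has a limit at $z=z_0$ with nonzero second component, and $$\frac{V_{l,1}(x,t;z_0)}{V_{l,2}(x,t;z_0)}=e^{\sqrt{\frac{\omega}{c+\omega}}(y+\wp)-x+ct}=\exp\Big\{\int_{-\infty}^x\Big(\sqrt{\tfrac{m+\omega}{c+\omega}}-1\Big)dr\Big\},$$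 $$V_{l,1}V_{l,2}=\sqrt{\tfrac{m+\omega}{c+\omega}}\Big(1+\tfrac{2i(u(x,t)-c)}{\omega s}(z-z_0)+O\big((z-z_0)^2\big)\Big),\quad z\to z_0$$ (here $\omega s=\sqrt{\omega(c+\omega)}$ if $\omega>0$). (3) Consequently $u$ is given in parametric form: for each $t\ge0$, $x\mapsto y(x,t)$ is an increasing bijection of $\mathbb R$, and $$x=y+\ln\frac{V_{r,1}}{V_{r,2}}\Big|_{k=i/2},\qquad u=\frac{\omega}{2i}\,\frac{\partial_k(V_{r,1}V_{r,2})}{V_{r,1}V_{r,2}}\Big|_{k=i/2},$$ $$x=\sqrt{\tfrac{\omega}{c+\omega}}(y+\wp)+ct-\ln\frac{V_{l,1}}{V_{l,2}}\Big|_{z=z_0},\qquad u=c+\frac{\omega s}{2i}\,\frac{\partial_z(V_{l,1}V_{l,2})}{V_{l,1}V_{l,2}}\Big|_{z=z_0}.$$ -/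

import Mathlib

open Filter Topology Asymptotics MeasureTheory

noncomputable section

namespace CamassaHolm

/-- The momentum `m = u - u_xx` (functions of space `x` and time `t`, in this order). -/
def momentum (u : ℝ → ℝ → ℝ) (x t : ℝ) : ℝ :=
  u x t - iteratedDeriv 2 (fun ξ => u ξ t) x

/-- The Heaviside function. -/
def heaviside (x : ℝ) : ℝ := if 0 ≤ x then 1 else 0

/-- The integrand `(1+|x|)^(l+1) (|m - c H(-x)| + |m_x| + |m_xx|)` of the decay condition. -/
def decayWeight (l : ℕ) (c : ℝ) (u : ℝ → ℝ → ℝ) (t x : ℝ) : ℝ :=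
  (1 + |x|) ^ (l + 1) *
    (|momentum u x t - c * heaviside (-x)|
      + |deriv (fun ξ => momentum u ξ t) x|
      + |iteratedDeriv 2 (fun ξ => momentum u ξ t) x|)

/-- `u` is a real classical solution, for `t ≥ 0`, of the Camassa-Holm equation
`u_t - u_txx + 2 ω u_x + 3 u u_x = 2 u_x u_xx + u u_xxx`
that tends rapidly to `c` as `x → -∞` and to `0` as `x → +∞`
and satisfies `(m + ω) / ω > 0`. -/
structure IsStepSolution (ω c : ℝ) (l : ℕ) (u : ℝ → ℝ → ℝ) : Prop where
  continuousOn : ContinuousOn (fun p : ℝ × ℝ => u p.1 p.2) (Set.univ ×ˢ Set.Ici 0)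
  contDiff_x : ∀ t, 0 ≤ t → ContDiff ℝ 3 (fun x => u x t)
  differentiable_mx : ∀ t, 0 ≤ t → Differentiable ℝ (deriv (fun x => momentum u x t))
  differentiableAt_t : ∀ x t, 0 < t → DifferentiableAt ℝ (fun s => u x s) t
  contDiff_ut : ∀ t, 0 < t → ContDiff ℝ 2 (fun x => deriv (fun s => u x s) t)
  equation : ∀ x t, 0 < t →
    deriv (fun s => u x s) t - iteratedDeriv 2 (fun ξ => deriv (fun s => u ξ s) t) x
        + 2 * ω * deriv (fun ξ => u ξ t) x + 3 * u x t * deriv (fun ξ => u ξ t) x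
      = 2 * deriv (fun ξ => u ξ t) x * iteratedDeriv 2 (fun ξ => u ξ t) x
        + u x t * iteratedDeriv 3 (fun ξ => u ξ t) x
  tendsto_atBot : ∀ t, 0 ≤ t → Tendsto (fun x => u x t) atBot (𝓝 c)
  tendsto_atTop : ∀ t, 0 ≤ t → Tendsto (fun x => u x t) atTop (𝓝 0)
  decay : ∀ T, 0 ≤ T → ∃ C : ℝ, ∀ t ∈ Set.Icc 0 T,
    Integrable (decayWeight l c u t) ∧ ∫ x, decayWeight l c u t x ≤ C
  positive : ∀ x t, 0 ≤ t → 0 < (momentum u x t + ω) / ω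

/-- The Liouville variable `y(x,t)`. -/
def liouvilleY (ω : ℝ) (u : ℝ → ℝ → ℝ) (x t : ℝ) : ℝ :=
  x - ∫ r in Set.Ioi x, (√((momentum u r t + ω) / ω) - 1)

/-- The conserved quantity `℘`. -/
def wp (ω c : ℝ) (u : ℝ → ℝ → ℝ) (x t : ℝ) : ℝ :=
  x * (√((c + ω) / ω) - 1) - c * √((c + ω) / ω) * t
    + (∫ r in Set.Iic x, (√((momentum u r t + ω) / ω) - √((c + ω) / ω)))
    + ∫ r in Set.Ioi x, (√((momentum u r t + ω) / ω) - 1)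

/-- The spectral parameter `λ = k² + 1/4`. -/
def lam (k : ℂ) : ℂ := k ^ 2 + 1 / 4

/-- `z(k) = √(k² + c/(4(c+ω)))`, cut along the segment between `±i √(c/(4(c+ω)))`,
with `z ~ k` at infinity (`Complex.cpow` is the principal branch, and
`1 + c/(4(c+ω)k²)` is a nonpositive real exactly when `k ≠ 0` is on that segment). -/
def zOf (ω c : ℝ) (k : ℂ) : ℂ :=
  k * (1 + (c / (4 * (c + ω)) : ℂ) / k ^ 2) ^ (1 / 2 : ℂ)

/-- The inverse function `k(z) = √(z² - c/(4(c+ω)))` on `Im z ≠ 0`, with `k ~ z` at infinity. -/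
def kOf (ω c : ℝ) (z : ℂ) : ℂ :=
  z * (1 - (c / (4 * (c + ω)) : ℂ) / z ^ 2) ^ (1 / 2 : ℂ)

/-- `φ` solves `ω/(m+ω) (-φ_xx + φ/4) = λ φ` on the line, at time `t`. -/
def SolvesXEquation (ω : ℝ) (u : ℝ → ℝ → ℝ) (t : ℝ) (k : ℂ) (φ : ℝ → ℂ) : Prop :=
  Differentiable ℝ φ ∧ Differentiable ℝ (deriv φ) ∧
    ∀ x, ((ω / (momentum u x t + ω) : ℝ) : ℂ) * (-deriv (deriv φ) x + φ x / 4) = lam k * φ x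

/-- The characterization of the right Jost solution: `exp(-ikx + iωkt/(2λ)) φ → 1`
as `x → +∞`. -/
def IsJostPlus (ω : ℝ) (u : ℝ → ℝ → ℝ) (t : ℝ) (k : ℂ) (φ : ℝ → ℂ) : Prop :=
  SolvesXEquation ω u t k φ ∧
    Tendsto (fun x : ℝ =>
      Complex.exp (-Complex.I * k * x + Complex.I * ω * k * t / (2 * lam k)) * φ x)
      atTop (𝓝 1)

/-- The characterization of the left Jost solution:
`((c+ω)/ω)^(1/4) exp(i z √((c+ω)/ω) (x - (c + ω/(2λ)) t)) φ → 1` as `x → -∞`. -/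
def IsJostMinus (ω c : ℝ) (u : ℝ → ℝ → ℝ) (t : ℝ) (k : ℂ) (φ : ℝ → ℂ) : Prop :=
  SolvesXEquation ω u t k φ ∧
    Tendsto (fun x : ℝ =>
      ((((c + ω) / ω) ^ (1 / 4 : ℝ) : ℝ) : ℂ) *
        Complex.exp (Complex.I * zOf ω c k * ((√((c + ω) / ω) : ℝ) : ℂ) *
          (x - (c + ω / (2 * lam k)) * t)) * φ x)
      atBot (𝓝 1)

/-- The right Jost solution `φ₊(x,t;k)`. -/
def jostPlus (ω : ℝ) (u : ℝ → ℝ → ℝ) (x t : ℝ) (k : ℂ) : ℂ :=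
  Classical.epsilon (IsJostPlus ω u t k) x

/-- The left Jost solution `φ₋(x,t;k)`. -/
def jostMinus (ω c : ℝ) (u : ℝ → ℝ → ℝ) (x t : ℝ) (k : ℂ) : ℂ :=
  Classical.epsilon (IsJostMinus ω c u t k) x

/-- The Wronskian `φ₋ ∂ₓφ₊ - φ₊ ∂ₓφ₋`. -/
def wronskian (ω c : ℝ) (u : ℝ → ℝ → ℝ) (x t : ℝ) (k : ℂ) : ℂ :=
  jostMinus ω c u x t k * deriv (fun ξ => jostPlus ω u ξ t k) x
    - jostPlus ω u x t k * deriv (fun ξ => jostMinus ω c u ξ t k) x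

/-- The spectral function `a₊(k) = W / (2ik)`. -/
def aPlus (ω c : ℝ) (u : ℝ → ℝ → ℝ) (x t : ℝ) (k : ℂ) : ℂ :=
  wronskian ω c u x t k / (2 * Complex.I * k)

/-- The spectral function `a₋(k) = W / (2iz(k))`. -/
def aMinus (ω c : ℝ) (u : ℝ → ℝ → ℝ) (x t : ℝ) (k : ℂ) : ℂ :=
  wronskian ω c u x t k / (2 * Complex.I * zOf ω c k)

/-- The phase `g = k y - 2ωkt/(4k²+1)`. -/
def phaseR (ω : ℝ) (u : ℝ → ℝ → ℝ) (x t : ℝ) (k : ℂ) : ℂ :=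
  k * liouvilleY ω u x t - 2 * ω * k * t / (4 * k ^ 2 + 1)

/-- The phase `g̃ = z (y + ℘) - 2 ω √((c+ω)/ω) z t / (4z² + ω/(c+ω))`;
here `ω √((c+ω)/ω)` is `√((c+ω)ω)` if `ω > 0`. -/
def phaseL (ω c : ℝ) (u : ℝ → ℝ → ℝ) (x t : ℝ) (z : ℂ) : ℂ :=
  z * (liouvilleY ω u x t + wp ω c u x t)
    - 2 * ((ω * √((c + ω) / ω) : ℝ) : ℂ) * z * t / (4 * z ^ 2 + ((ω / (c + ω) : ℝ) : ℂ))

/-- The factor `((m+ω)/ω)^(1/4)`. -/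
def liouvilleFactor (ω : ℝ) (u : ℝ → ℝ → ℝ) (x t : ℝ) : ℂ :=
  ((((momentum u x t + ω) / ω) ^ (1 / 4 : ℝ) : ℝ) : ℂ)

open scoped Classical in
/-- The value of `F` with the singularities at the points of `S` removed by continuity. -/
def fillIn (S : Set ℂ) (F : ℂ → ℂ × ℂ) (k : ℂ) : ℂ × ℂ :=
  if k ∈ S then limUnder (𝓝[≠] k) F else F k

open scoped ComplexConjugate in
/-- The defining formula of `V_r(x,t;k)`, off the contour `Im z(k) = 0` and off the points `λ = 0`
(on the contour itself the second line has no meaning). -/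
def formulaVr (ω c : ℝ) (u : ℝ → ℝ → ℝ) (x t : ℝ) (k : ℂ) : ℂ × ℂ :=
  if 0 < (zOf ω c k).im then
    (liouvilleFactor ω u x t * (1 / aPlus ω c u x t k * jostMinus ω c u x t k *
        Complex.exp (Complex.I * phaseR ω u x t k)),
     liouvilleFactor ω u x t * (jostPlus ω u x t k *
        Complex.exp (-Complex.I * phaseR ω u x t k)))
  else
    (liouvilleFactor ω u x t * (conj (jostPlus ω u x t (conj k)) *
        Complex.exp (Complex.I * phaseR ω u x t k)),
     liouvilleFactor ω u x t * (1 / conj (aPlus ω c u x t (conj k)) *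
        conj (jostMinus ω c u x t (conj k)) *
        Complex.exp (-Complex.I * phaseR ω u x t k)))

/-- The row vector `V_r(x,t;k)`; the exponents in its formula have poles at `λ = 0`, that is at
`k = ±i/2`, which cancel, and there the value is the limit. -/
def Vr (ω c : ℝ) (u : ℝ → ℝ → ℝ) (x t : ℝ) : ℂ → ℂ × ℂ :=
  fillIn {k | lam k = 0} (formulaVr ω c u x t)

open scoped ComplexConjugate in
/-- The defining formula of `V_l(x,t;z)`, off the real line and off the points `λ = 0`. -/
def formulaVl (ω c : ℝ) (u : ℝ → ℝ → ℝ) (x t : ℝ) (z : ℂ) : ℂ × ℂ :=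
  if 0 < z.im then
    (liouvilleFactor ω u x t * (1 / aMinus ω c u x t (kOf ω c z) *
        jostPlus ω u x t (kOf ω c z) * Complex.exp (-Complex.I * phaseL ω c u x t z)),
     liouvilleFactor ω u x t * (jostMinus ω c u x t (kOf ω c z) *
        Complex.exp (Complex.I * phaseL ω c u x t z)))
  else
    (liouvilleFactor ω u x t * (conj (jostMinus ω c u x t (conj (kOf ω c z))) *
        Complex.exp (-Complex.I * phaseL ω c u x t z)),
     liouvilleFactor ω u x t * (1 / conj (aMinus ω c u x t (conj (kOf ω c z))) *
        conj (jostPlus ω u x t (conj (kOf ω c z))) *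
        Complex.exp (Complex.I * phaseL ω c u x t z)))

/-- The row vector `V_l(x,t;z)`; at the points `λ = z² + ω/(4(c+ω)) = 0` the value is the limit. -/
def Vl (ω c : ℝ) (u : ℝ → ℝ → ℝ) (x t : ℝ) : ℂ → ℂ × ℂ :=
  fillIn {z | z ^ 2 + ((ω / (4 * (c + ω)) : ℝ) : ℂ) = 0} (formulaVl ω c u x t)

end CamassaHolm

end

open CamassaHolm

namespace CamassaHolm

open Set

/-! ### Tail integrals and the resolvent of `∂ₓ - β` -/

/-! At `λ = 0` the spectral problem `φ'' = (1/4 - λ (m+ω)/ω) φ` no longer sees the potential, so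
near `λ = 0` the Jost solutions can be expanded in powers of `λ`, and the first-order term already
contains `u`. Write `(m+ω)/ω = p + d`, with `p` the limit at the end in question, and set `w = φ'/φ
+ μ`, where `μ² = 1/4 - λ p` and `φ ~ exp(-μ x)`. Then `w' = 2μ w - λ d - w²`. For small `λ` the
bounded solution is found by a contraction argument (`IsTailPotential.exists_riccati`), and it
agrees with `λ J` up to `O(λ²)`, where `J` is the bounded solution of `J' = J - d`. Since `u - u_xx
= m`, one has `J = (u + u_x)/ω` at the right end and, after the reflection `x ↦ -x`, `J = (u - c -
u_x)/ω` at the left end.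

The Wronskian divided by `φ₋ φ₊` is the difference of the two logarithmic derivatives. There `u_x`
cancels, and `2ik φ₋φ₊/W = 1 + (2u/ω) λ + O(λ²)`; the left normalization gives the same with `u - c`
(`IsStepSolution.jost_asymptotics`). Up to the Liouville factor these are the products of the
components of `V_r` and `V_l`, because the exponentials cancel in the product. Substituting `λ` as a
function of `k` or `z` gives the expansions.

The second components contain a single Jost solution and no transmission factor. Their exponents
have poles at `λ = 0`, proportional to `t`, which cancel against the time factor in the Jost
normalization, so these components have explicit nonzero limits. The ratio of the components is the
product divided by the square of the second one. -/

theorem integrableOn_Ioi_of_continuous {E : Type*} [NormedAddCommGroup E] {f : ℝ → E}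
    (hf : Continuous f) {a : ℝ} (hi : IntegrableOn f (Ioi a)) (b : ℝ) :
    IntegrableOn f (Ioi b) := by
  refine ((hf.integrableOn_Icc (a := b) (b := a)).union hi).mono_set fun x hx => ?_
  rcases le_or_gt x a with h | h
  · exact Or.inl ⟨le_of_lt hx, h⟩
  · exact Or.inr h

theorem hasDerivAt_integral_Ioi {E : Type*} [NormedAddCommGroup E] [NormedSpace ℝ E]
    [CompleteSpace E] {f : ℝ → E} (hf : Continuous f) {a : ℝ} (hi : IntegrableOn f (Ioi a))
    (x : ℝ) : HasDerivAt (fun x => ∫ r in Ioi x, f r) (-f x) x := by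
  have h1 : (fun x => ∫ r in Ioi x, f r) = fun x => (∫ r in Ioi a, f r) - ∫ r in a..x, f r := by
    funext y
    have := intervalIntegral.integral_Ioi_sub_Ioi' hi (integrableOn_Ioi_of_continuous hf hi y)
    rw [← this]; abel
  rw [h1]
  simpa using (intervalIntegral.integral_hasDerivAt_right (hf.intervalIntegrable a x)
    (hf.stronglyMeasurableAtFilter _ _) hf.continuousAt).const_sub (∫ r in Ioi a, f r)

theorem norm_exp_neg_mul_ofReal (β : ℂ) (r : ℝ) :
    ‖Complex.exp (-β * r)‖ = Real.exp (-β.re * r) := by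
  rw [Complex.norm_exp]; simp

/-- The bounded solution of `w' = β w - h`. -/
noncomputable def resolventInt (β : ℂ) (h : ℝ → ℂ) (x : ℝ) : ℂ :=
  Complex.exp (β * x) * ∫ r in Ioi x, Complex.exp (-β * r) * h r

variable {β : ℂ} {h : ℝ → ℂ}

theorem integrableOn_exp_neg_mul (hβ : 0 < β.re) (hc : Continuous h) {K : ℝ} {x : ℝ}
    (hK : ∀ r ∈ Ioi x, ‖h r‖ ≤ K) :
    IntegrableOn (fun r : ℝ => Complex.exp (-β * r) * h r) (Ioi x) := by
  have h1 : IntegrableOn (fun r : ℝ => Complex.exp (-β * r)) (Ioi x) :=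
    integrableOn_exp_mul_complex_Ioi (by simpa using hβ) x
  refine Integrable.mul_bdd h1 hc.aestronglyMeasurable (c := K) ?_
  exact (ae_restrict_iff' measurableSet_Ioi).2 (Eventually.of_forall hK)

theorem hasDerivAt_resolventInt (hβ : 0 < β.re) (hc : Continuous h) {K : ℝ}
    (hK : ∀ r, ‖h r‖ ≤ K) (x : ℝ) :
    HasDerivAt (resolventInt β h) (β * resolventInt β h x - h x) x := by
  have h1 := hasDerivAt_integral_Ioi (f := fun r : ℝ => Complex.exp (-β * r) * h r)
    (by fun_prop) (integrableOn_exp_neg_mul hβ hc (x := 0) fun r _ => hK r) x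
  have h2 : HasDerivAt (fun x : ℝ => Complex.exp (β * x)) (Complex.exp (β * x) * (β * 1)) x :=
    (((hasDerivAt_id (x : ℂ)).const_mul β).cexp).comp_ofReal
  refine (h2.mul h1).congr_deriv ?_
  have : Complex.exp (β * x) * Complex.exp (-β * x) = 1 := by
    rw [← Complex.exp_add]; simp
  simp only [resolventInt]
  linear_combination (-h x) * this

/-- The kernel `exp(β (x - r))` on `r > x` has total mass `1 / Re β`. Only values to the right of
`x` enter, so a decreasing majorant of `h` is passed on to the resolvent. -/
theorem norm_resolventInt_le (hβ : 0 < β.re) {K : ℝ} {x : ℝ} (hK : ∀ r ∈ Ioi x, ‖h r‖ ≤ K) :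
    ‖resolventInt β h x‖ ≤ K / β.re := by
  have hg : IntegrableOn (fun r : ℝ => Real.exp (-β.re * r)) (Ioi x) :=
    integrableOn_exp_mul_Ioi (by simpa using hβ) x
  have h1 : ‖∫ r in Ioi x, Complex.exp (-β * r) * h r‖
      ≤ ∫ r in Ioi x, Real.exp (-β.re * r) * K := by
    refine norm_integral_le_of_norm_le (hg.mul_const K) ?_
    refine (ae_restrict_iff' measurableSet_Ioi).2 (Eventually.of_forall fun r hr => ?_)
    rw [norm_mul, norm_exp_neg_mul_ofReal]
    exact mul_le_mul_of_nonneg_left (hK r hr) (Real.exp_pos _).le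
  rw [integral_mul_const, integral_exp_mul_Ioi (by simpa using hβ)] at h1
  have h2 : ‖Complex.exp (β * x)‖ = Real.exp (β.re * x) := by
    rw [Complex.norm_exp]; simp
  rw [resolventInt, norm_mul, h2]
  refine (mul_le_mul_of_nonneg_left h1 (Real.exp_pos _).le).trans (le_of_eq ?_)
  have : Real.exp (β.re * x) * Real.exp (-β.re * x) = 1 := by
    rw [← Real.exp_add]; simp
  rw [neg_div_neg_eq, div_mul_eq_mul_div, mul_div_assoc', ← mul_assoc, this, one_mul]

/-- The kernel has modulus at most one for `r > x`. This keeps the decay of the tail of `h`, which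
the supremum bound loses. -/
theorem norm_resolventInt_le_integral (hβ : 0 ≤ β.re) {x : ℝ} {D : ℝ → ℝ}
    (hD : IntegrableOn D (Ioi x)) (hhD : ∀ r ∈ Ioi x, ‖h r‖ ≤ D r) :
    ‖resolventInt β h x‖ ≤ ∫ r in Ioi x, D r := by
  have h2 : ‖Complex.exp (β * x)‖ = Real.exp (β.re * x) := by
    rw [Complex.norm_exp]; simp
  rw [resolventInt, ← integral_const_mul]
  refine norm_integral_le_of_norm_le hD ?_
  refine (ae_restrict_iff' measurableSet_Ioi).2 (Eventually.of_forall fun r hr => ?_)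
  rw [norm_mul, norm_mul, norm_exp_neg_mul_ofReal, h2, ← mul_assoc, ← Real.exp_add]
  refine (mul_le_of_le_one_left (norm_nonneg _) ?_).trans (hhD r hr)
  rw [Real.exp_le_one_iff]
  nlinarith [mem_Ioi.1 hr]

theorem resolventInt_add (hβ : 0 < β.re) {g : ℝ → ℂ} (hc : Continuous h) (gc : Continuous g)
    {K L : ℝ} (hK : ∀ r, ‖h r‖ ≤ K) (hL : ∀ r, ‖g r‖ ≤ L) (x : ℝ) :
    resolventInt β (fun r => h r + g r) x = resolventInt β h x + resolventInt β g x := by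
  simp only [resolventInt, mul_add]
  rw [integral_add (integrableOn_exp_neg_mul hβ hc fun r _ => hK r)
    (integrableOn_exp_neg_mul hβ gc fun r _ => hL r), mul_add]

theorem resolventInt_sub (hβ : 0 < β.re) {g : ℝ → ℂ} (hc : Continuous h) (gc : Continuous g)
    {K L : ℝ} (hK : ∀ r, ‖h r‖ ≤ K) (hL : ∀ r, ‖g r‖ ≤ L) (x : ℝ) :
    resolventInt β (fun r => h r - g r) x = resolventInt β h x - resolventInt β g x := by
  simp only [resolventInt, mul_sub]
  rw [integral_sub (integrableOn_exp_neg_mul hβ hc fun r _ => hK r)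
    (integrableOn_exp_neg_mul hβ gc fun r _ => hL r), mul_sub]

/-- A bounded solution of `e' = β e - g` is bounded by `sup ‖g‖ / Re β`. -/
theorem norm_le_of_hasDerivAt_of_bounded (hβ : 0 < β.re) {e g : ℝ → ℂ} (gc : Continuous g)
    {K L : ℝ} (hK : ∀ r, ‖g r‖ ≤ K) (hL : ∀ r, ‖e r‖ ≤ L)
    (he : ∀ x, HasDerivAt e (β * e x - g x) x) (x : ℝ) : ‖e x‖ ≤ K / β.re := by
  -- The difference of two solutions is a multiple of `exp(β x)`; since both are bounded, the
  -- multiple vanishes.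
  have hE : ∀ y, HasDerivAt (fun y : ℝ => Complex.exp (-β * y) * (e y - resolventInt β g y)) 0 y := by
    intro y
    have h2 : HasDerivAt (fun x : ℝ => Complex.exp (-β * x)) (Complex.exp (-β * y) * (-β * 1)) y :=
      (((hasDerivAt_id (y : ℂ)).const_mul (-β)).cexp).comp_ofReal
    refine (h2.mul ((he y).sub (hasDerivAt_resolventInt hβ gc hK y))).congr_deriv ?_
    simp only [Pi.sub_apply]
    ring
  have hconst : ∀ y : ℝ, Complex.exp (-β * y) * (e y - resolventInt β g y)
      = Complex.exp (-β * x) * (e x - resolventInt β g x) := fun y =>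
    is_const_of_deriv_eq_zero (fun y => (hE y).differentiableAt) (fun y => (hE y).deriv) y x
  have hlim : Tendsto (fun y : ℝ => Real.exp (-β.re * y) * (L + K / β.re)) atTop (𝓝 0) := by
    have : Tendsto (fun y : ℝ => Real.exp (-β.re * y)) atTop (𝓝 0) :=
      Real.tendsto_exp_atBot.comp (tendsto_id.const_mul_atTop_of_neg (by simpa using hβ))
    simpa using this.mul_const (L + K / β.re)
  have h0 : ‖Complex.exp (-β * x) * (e x - resolventInt β g x)‖ ≤ 0 := by
    refine ge_of_tendsto' hlim fun y => ?_
    rw [← hconst y, norm_mul, norm_exp_neg_mul_ofReal]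
    refine mul_le_mul_of_nonneg_left ?_ (Real.exp_pos _).le
    exact (norm_sub_le _ _).trans (add_le_add (hL y) (norm_resolventInt_le hβ fun r _ => hK r))
  have h1 : e x - resolventInt β g x = 0 := by
    have := norm_le_zero_iff.1 h0
    exact (mul_eq_zero.1 this).resolve_left (Complex.exp_ne_zero _)
  rw [sub_eq_zero.1 h1]
  exact norm_resolventInt_le hβ fun r _ => hK r

/-- The tail of a function with a finite first moment is integrable. -/
theorem integrableOn_tail {D : ℝ → ℝ} (hD : Continuous D) (hD0 : ∀ r, 0 ≤ D r)
    (hi : IntegrableOn D (Ioi 0)) (hi1 : IntegrableOn (fun r => r * D r) (Ioi 0)) :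
    IntegrableOn (fun x => ∫ r in Ioi x, D r) (Ioi 0) := by
  have hT := hasDerivAt_integral_Ioi hD hi
  set T : ℝ → ℝ := fun x => ∫ r in Ioi x, D r with hTdef
  have hTc : Continuous T := continuous_iff_continuousAt.2 fun x => (hT x).continuousAt
  have hT0 : ∀ x, 0 ≤ T x := fun x => setIntegral_nonneg measurableSet_Ioi fun r _ => hD0 r
  have hi1' : ∀ x, IntegrableOn (fun r => r * D r) (Ioi x) :=
    integrableOn_Ioi_of_continuous (by fun_prop) hi1
  refine integrableOn_Ioi_of_intervalIntegral_norm_bounded (∫ r in Ioi 0, r * D r) 0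
    (fun i : ℝ => hTc.integrableOn_Ioc) tendsto_id ?_
  filter_upwards [eventually_ge_atTop 0] with X hX
  have hXT : X * T X ≤ ∫ r in Ioi X, r * D r := by
    rw [hTdef]
    simp only
    rw [← integral_const_mul]
    refine setIntegral_mono_on ((integrableOn_Ioi_of_continuous hD hi X).const_mul X) (hi1' X)
      measurableSet_Ioi fun r hr => mul_le_mul_of_nonneg_right (le_of_lt hr) (hD0 r)
  -- Integration by parts: `(x T)' = T - x D`, so the integral of `T` over `[0, X]` is `X T(X)` plus
  -- that of `x D`, and `X T(X)` is at most the remaining tail of the moment.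
  have hder : ∀ x ∈ uIcc 0 X, HasDerivAt (fun x => x * T x) (T x - x * D x) x := fun x _ =>
    ((hasDerivAt_id x).mul (hT x)).congr_deriv (by simp; ring)
  have hint := intervalIntegral.integral_eq_sub_of_hasDerivAt hder
    ((by fun_prop : Continuous fun x => T x - x * D x).intervalIntegrable _ _)
  rw [intervalIntegral.integral_sub (hTc.intervalIntegrable _ _)
    ((by fun_prop : Continuous fun x => x * D x).intervalIntegrable _ _)] at hint
  have hsplit := intervalIntegral.integral_Ioi_sub_Ioi' hi1 (hi1' X)
  have hn : ∫ x in (0 : ℝ)..X, ‖T x‖ = ∫ x in (0 : ℝ)..X, T x :=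
    intervalIntegral.integral_congr fun x _ => Real.norm_of_nonneg (hT0 x)
  simp only [id]
  rw [hn]
  linarith

/-! ### Decaying solutions of `φ'' = (1/4 - λ (P∞ + d)) φ` for small `λ` -/

/-- A bounded perturbation `d` with a finite first moment at `+∞`, together with a bounded solution
`J` of `J' = J - d`. -/
structure IsTailPotential (d J : ℝ → ℝ) (M : ℝ) : Prop where
  pos : 0 < M
  continuous : Continuous d
  abs_d_le : ∀ x, |d x| ≤ M
  hasDerivAt : ∀ x, HasDerivAt J (J x - d x) x
  abs_J_le : ∀ x, |J x| ≤ M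
  integrable : IntegrableOn (fun x => |d x|) (Ioi 0)
  integrable_moment : IntegrableOn (fun x => x * |d x|) (Ioi 0)

/-- The Riccati equation `w' = β w - λ d - w²` has a small solution on the whole line, which is
controlled by the tail of `d`. -/
theorem IsTailPotential.exists_riccati {d J : ℝ → ℝ} {M : ℝ} (H : IsTailPotential d J M) {β ev : ℂ}
    (hβ : 1 / 2 ≤ β.re) (hev : ‖ev‖ * M ≤ 1 / 32) :
    ∃ w : ℝ → ℂ, Continuous w ∧ (∀ x, ‖w x‖ ≤ 4 * ‖ev‖ * M) ∧
      (∀ x, ‖w x‖ ≤ 2 * ‖ev‖ * ∫ r in Ioi x, |d r|) ∧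
      ∀ x, HasDerivAt w (β * w x - (ev * d x + w x ^ 2)) x := by
  have hβ0 : 0 < β.re := by linarith
  have hM := H.pos
  have hdc := H.continuous
  have hn := norm_nonneg ev
  have hT := hasDerivAt_integral_Ioi hdc.abs H.integrable
  set T : ℝ → ℝ := fun x => ∫ r in Ioi x, |d r| with hTdef
  have hT0 : ∀ x, 0 ≤ T x := fun x => setIntegral_nonneg measurableSet_Ioi fun r _ => abs_nonneg _
  have hTanti : Antitone T := antitone_of_deriv_nonpos (fun x => (hT x).differentiableAt)
    fun x => by rw [(hT x).deriv]; simp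
  have hdiv : ∀ {K : ℝ}, 0 ≤ K → K / β.re ≤ 2 * K := fun {K} hK => by
    rw [div_le_iff₀ hβ0]; nlinarith
  have hsrc : ∀ r, ‖ev * (d r : ℂ)‖ ≤ ‖ev‖ * |d r| := fun r => by simp
  have hsrcM : ∀ r, ‖ev * (d r : ℂ)‖ ≤ ‖ev‖ * M := fun r =>
    (hsrc r).trans (mul_le_mul_of_nonneg_left (H.abs_d_le r) hn)
  have hsrcc : Continuous fun r => ev * (d r : ℂ) := by fun_prop
  have hsq : ∀ (w : BoundedContinuousFunction ℝ ℂ) r, ‖w r ^ 2‖ ≤ ‖w‖ ^ 2 := fun w r => by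
    rw [norm_pow]; exact pow_le_pow_left₀ (norm_nonneg _) (w.norm_coe_le_norm r) 2
  have hrhs : ∀ (w : BoundedContinuousFunction ℝ ℂ) r,
      ‖ev * (d r : ℂ) + w r ^ 2‖ ≤ ‖ev‖ * M + ‖w‖ ^ 2 := fun w r =>
    (norm_add_le _ _).trans (add_le_add (hsrcM r) (hsq w r))
  have hder : ∀ (w : BoundedContinuousFunction ℝ ℂ) x,
      HasDerivAt (resolventInt β fun r => ev * d r + w r ^ 2)
        (β * resolventInt β (fun r => ev * d r + w r ^ 2) x - (ev * d x + w x ^ 2)) x := fun w x =>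
    hasDerivAt_resolventInt hβ0 (by fun_prop) (hrhs w) x
  -- Fixed points of `Φ` are the bounded solutions of the Riccati equation, with `λ d + w²` treated
  -- as the source.
  let Φ : BoundedContinuousFunction ℝ ℂ → BoundedContinuousFunction ℝ ℂ := fun w =>
    BoundedContinuousFunction.ofNormedAddCommGroup (resolventInt β fun r => ev * d r + w r ^ 2)
      (continuous_iff_continuousAt.2 fun x => (hder w x).continuousAt)
      ((‖ev‖ * M + ‖w‖ ^ 2) / β.re) fun x => norm_resolventInt_le hβ0 fun r _ => hrhs w r
  have hΦ : ∀ w x, Φ w x = resolventInt β (fun r => ev * d r + w r ^ 2) x := fun _ _ => rfl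
  -- The uniform bound makes `Φ` a contraction on `S`; the tail bound makes the fixed point
  -- integrable at `+∞`. Both are preserved together because `w²` is estimated by one bound times
  -- the other.
  let S : Set (BoundedContinuousFunction ℝ ℂ) :=
    {w | (∀ x, ‖w x‖ ≤ 4 * ‖ev‖ * M) ∧ ∀ x, ‖w x‖ ≤ 2 * ‖ev‖ * T x}
  have hS : IsClosed S := by
    have hx : ∀ x, Continuous fun w : BoundedContinuousFunction ℝ ℂ => ‖w x‖ := fun x =>
      by fun_prop
    simp only [S, ofPred_and, ofPred_forall]
    exact (isClosed_iInter fun x => isClosed_le (hx x) continuous_const).inter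
      (isClosed_iInter fun x => isClosed_le (hx x) continuous_const)
  have hball : ∀ w ∈ S, ‖w‖ ≤ 4 * ‖ev‖ * M := fun w hw =>
    (BoundedContinuousFunction.norm_le (by positivity)).2 hw.1
  have hmaps : MapsTo Φ S S := by
    intro w hw
    have hb := hball w hw
    have hwn := norm_nonneg w
    refine ⟨fun x => ?_, fun x => ?_⟩
    · refine (norm_resolventInt_le hβ0 fun r _ => hrhs w r).trans ((hdiv (by positivity)).trans ?_)
      nlinarith [mul_nonneg hn hM.le]
    · rw [hΦ, resolventInt_add hβ0 hsrcc (by fun_prop) hsrcM (hsq w)]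
      have h1 : ‖resolventInt β (fun r => ev * (d r : ℂ)) x‖ ≤ ‖ev‖ * T x := by
        rw [hTdef]
        simp only
        rw [← integral_const_mul]
        exact norm_resolventInt_le_integral hβ0.le
          ((integrableOn_Ioi_of_continuous hdc.abs H.integrable x).const_mul _) fun r _ => hsrc r
      have h2 : ‖resolventInt β (fun r => w r ^ 2) x‖
          ≤ (4 * ‖ev‖ * M) * (2 * ‖ev‖ * T x) / β.re := by
        refine norm_resolventInt_le hβ0 fun r hr => ?_
        rw [norm_pow, sq]
        refine mul_le_mul (hw.1 r) ((hw.2 r).trans ?_) (norm_nonneg _) (by positivity)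
        exact mul_le_mul_of_nonneg_left (hTanti (le_of_lt hr)) (by positivity)
      have h3 := hdiv (K := (4 * ‖ev‖ * M) * (2 * ‖ev‖ * T x))
        (mul_nonneg (by positivity) (mul_nonneg (by positivity) (hT0 x)))
      refine (norm_add_le _ _).trans ?_
      have h4 := mul_nonneg hn (hT0 x)
      nlinarith [mul_le_mul_of_nonneg_right hev h4]
  -- From `v² - w² = (v + w)(v - w)` and `1 / Re β ≤ 2` the Lipschitz constant is `16 ‖ev‖ M`, hence
  -- the threshold `1/32`.
  have hcontr : ContractingWith (1 / 2) (hmaps.restrict Φ S S) := by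
    refine ⟨by rw [← NNReal.coe_lt_coe]; norm_num, LipschitzWith.of_dist_le_mul fun v w => ?_⟩
    have hv := hball v v.2
    have hw := hball w w.2
    simp only [Subtype.dist_eq, MapsTo.val_restrict_apply]
    refine (BoundedContinuousFunction.dist_le (by positivity)).2 fun x => ?_
    rw [dist_eq_norm, hΦ, hΦ, ← resolventInt_sub hβ0 (by fun_prop) (by fun_prop) (hrhs v) (hrhs w)]
    have h1 : ∀ r ∈ Ioi x, ‖ev * (d r : ℂ) + v.1 r ^ 2 - (ev * d r + w.1 r ^ 2)‖
        ≤ (8 * ‖ev‖ * M) * dist v.1 w.1 := fun r _ => by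
      have e : ev * (d r : ℂ) + v.1 r ^ 2 - (ev * d r + w.1 r ^ 2)
        = (v.1 r + w.1 r) * (v.1 r - w.1 r) := by ring
      rw [e, norm_mul]
      refine mul_le_mul ?_ ?_ (norm_nonneg _) (by positivity)
      · refine (norm_add_le _ _).trans ?_
        linarith [v.2.1 r, w.2.1 r]
      · rw [← dist_eq_norm]; exact BoundedContinuousFunction.dist_coe_le_dist r
    refine (norm_resolventInt_le hβ0 h1).trans ((hdiv (by positivity)).trans ?_)
    simp only [NNReal.coe_div, NNReal.coe_one, NNReal.coe_ofNat]
    nlinarith [mul_le_mul_of_nonneg_right hev (dist_nonneg (x := v.1) (y := w.1))]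
  obtain ⟨w, hwS, hfix, -⟩ := hcontr.exists_fixedPoint' hS.isComplete hmaps
    (x := 0) ⟨fun x => by simp; positivity, fun x => by
      simpa using mul_nonneg (by positivity) (hT0 x)⟩ (edist_ne_top _ _)
  refine ⟨w, w.continuous, hwS.1, hwS.2, fun x => ?_⟩
  have h1 : ∀ y, resolventInt β (fun r => ev * d r + w r ^ 2) y = w y := fun y => by
    rw [← hΦ, hfix.eq]
  have h2 := hder w x
  rwa [show resolventInt β (fun r => ev * (d r : ℂ) + w r ^ 2) = w from funext h1] at h2

/-- For small `λ` the equation `φ'' = (1/4 - λ (P∞ + d)) φ` has a zero-free solution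
`φ ~ exp(-μ x)` at `+∞`, with first-order asymptotics of `φ'/φ` as `λ → 0`. -/
theorem IsTailPotential.exists_decaying_solution {d J : ℝ → ℝ} {M : ℝ} (H : IsTailPotential d J M)
    (p x₀ : ℝ) : ∃ δ > 0, ∃ C : ℝ, ∀ ev μ : ℂ, ‖ev‖ < δ → 0 < μ.re → μ ^ 2 = 1 / 4 - ev * p →
      ∃ φ φ' : ℝ → ℂ, (∀ x, HasDerivAt φ (φ' x) x) ∧
        (∀ x, HasDerivAt φ' ((1 / 4 - ev * (p + d x)) * φ x) x) ∧ (∀ x, φ x ≠ 0) ∧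
        Tendsto (fun x : ℝ => Complex.exp (μ * x) * φ x) atTop (𝓝 1) ∧
        Tendsto φ' atTop (𝓝 0) ∧
        ‖Complex.exp (μ * x₀) * φ x₀ - 1‖ ≤ C * ‖ev‖ ∧
        ‖φ' x₀ / φ x₀ + μ - ev * J x₀‖ ≤ C * ‖ev‖ ^ 2 := by
  have hM := H.pos
  have hTi : ∀ x, IntegrableOn (fun x => ∫ r in Ioi x, |d r|) (Ioi x) :=
    integrableOn_Ioi_of_continuous (continuous_iff_continuousAt.2 fun x =>
      (hasDerivAt_integral_Ioi H.continuous.abs H.integrable x).continuousAt)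
      (integrableOn_tail H.continuous.abs (fun _ => abs_nonneg _) H.integrable H.integrable_moment)
  have hT0 : ∀ x, 0 ≤ ∫ r in Ioi x, |d r| := fun x =>
    setIntegral_nonneg measurableSet_Ioi fun r _ => abs_nonneg _
  set A : ℝ := ∫ x in Ioi x₀, ∫ r in Ioi x, |d r| with hA
  have hA0 : 0 ≤ A := setIntegral_nonneg measurableSet_Ioi fun r _ => hT0 r
  -- The three bounds on `‖ev‖` serve the contraction, the inequality `Re (2μ) ≥ 1/2`, and `‖F‖ ≤ 1`
  -- in the estimate of `exp(-F) - 1`. In the constant, `4 A` comes from that last estimate and the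
  -- rest from comparing `w` with `ev J`.
  refine ⟨min (1 / (32 * M)) (min (1 / (8 * (|p| + 1))) (1 / (2 * (A + 1)))), by positivity,
    4 * A + (8 * |p| * M + 32 * M ^ 2), fun ev μ hev hμ0 hμ => ?_⟩
  have hn := norm_nonneg ev
  obtain ⟨hev1, hev2, hev3⟩ : ‖ev‖ * M ≤ 1 / 32 ∧ ‖ev‖ * |p| ≤ 1 / 8 ∧ 2 * ‖ev‖ * A ≤ 1 := by
    rw [lt_min_iff, lt_min_iff, lt_div_iff₀ (by positivity), lt_div_iff₀ (by positivity),
      lt_div_iff₀ (by positivity)] at hev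
    obtain ⟨h1, h2, h3⟩ := hev
    exact ⟨by linarith, by nlinarith, by nlinarith⟩
  have hμ1 : ‖2 * μ - 1‖ ≤ 4 * |p| * ‖ev‖ := by
    have h1 : (2 * μ - 1) * (2 * μ + 1) = -4 * ev * p := by linear_combination 4 * hμ
    have h2 : 1 ≤ ‖2 * μ + 1‖ := by
      refine le_trans ?_ (Complex.re_le_norm _)
      simp; linarith
    have h3 : ‖2 * μ - 1‖ * ‖2 * μ + 1‖ = 4 * ‖ev‖ * |p| := by
      rw [← norm_mul, h1]; simp
    nlinarith [norm_nonneg (2 * μ - 1)]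
  have hβ : 1 / 2 ≤ (2 * μ).re := by
    have := (abs_le.1 (Complex.abs_re_le_norm (2 * μ - 1))).1
    rw [Complex.sub_re, Complex.one_re] at this
    nlinarith
  obtain ⟨w, hwc, hwM, hwT, hw⟩ := H.exists_riccati hβ hev1
  have hwi : ∀ x, IntegrableOn w (Ioi x) := fun x =>
    Integrable.mono' ((hTi x).const_mul (2 * ‖ev‖)) hwc.aestronglyMeasurable
      (Eventually.of_forall hwT)
  -- The solution is recovered from its logarithmic derivative `w - μ`. The tail integral exists
  -- because the first moment of `d` is finite, and it normalizes `φ` at `+∞`.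
  set F : ℝ → ℂ := fun x => ∫ r in Ioi x, w r with hF
  have hFd : ∀ x, HasDerivAt F (-w x) x := hasDerivAt_integral_Ioi hwc (hwi 0)
  have hF0 : Tendsto F atTop (𝓝 0) := tendsto_integral_Ioi_zero tendsto_id
  have hφd : ∀ x : ℝ, HasDerivAt (fun x : ℝ => Complex.exp (-μ * x - F x))
      ((w x - μ) * Complex.exp (-μ * x - F x)) x := fun x => by
    have h1 : HasDerivAt (fun x : ℝ => -μ * (x : ℂ)) (-μ * 1) x :=
      ((hasDerivAt_id (x : ℂ)).const_mul (-μ)).comp_ofReal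
    refine (h1.sub (hFd x)).cexp.congr_deriv ?_
    simp only [Pi.sub_apply]; ring
  have hφlim : Tendsto (fun x : ℝ => Complex.exp (-μ * x - F x)) atTop (𝓝 0) := by
    have h1 : Tendsto (fun x : ℝ => Complex.exp (-μ * x)) atTop (𝓝 0) := by
      rw [tendsto_zero_iff_norm_tendsto_zero]
      simp only [norm_exp_neg_mul_ofReal]
      exact Real.tendsto_exp_atBot.comp (tendsto_id.const_mul_atTop_of_neg (by linarith))
    have h2 : Tendsto (fun x : ℝ => Complex.exp (- F x)) atTop (𝓝 1) := by
      simpa using hF0.neg.cexp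
    simpa [sub_eq_add_neg, Complex.exp_add] using h1.mul h2
  have hcancel : ∀ x : ℝ, Complex.exp (μ * x) * Complex.exp (-μ * x - F x) = Complex.exp (-F x) :=
    fun x => by rw [← Complex.exp_add]; ring_nf
  refine ⟨fun x => Complex.exp (-μ * x - F x), fun x => (w x - μ) * Complex.exp (-μ * x - F x),
    hφd, fun x => ?_, fun x => Complex.exp_ne_zero _, ?_, ?_, ?_, ?_⟩
  · refine (((hw x).sub_const μ).mul (hφd x)).congr_deriv ?_
    linear_combination Complex.exp (-μ * x - F x) * hμ
  · simp only [hcancel]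
    simpa using hF0.neg.cexp
  · refine hφlim.zero_mul_isBoundedUnder_le ?_ |>.congr fun x => mul_comm _ _
    refine isBoundedUnder_of ⟨4 * ‖ev‖ * M + ‖μ‖, fun x => ?_⟩
    exact (norm_sub_le _ _).trans (by gcongr; exact hwM x)
  · have h1 : ‖F x₀‖ ≤ 2 * ‖ev‖ * A := by
      rw [hA, ← integral_const_mul]
      exact norm_integral_le_of_norm_le ((hTi x₀).const_mul _) (Eventually.of_forall hwT)
    rw [hcancel]
    have h2 := Complex.norm_exp_sub_one_le (x := -F x₀) (by rw [norm_neg]; linarith)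
    rw [norm_neg] at h2
    refine h2.trans ?_
    have : 0 ≤ (8 * |p| * M + 32 * M ^ 2) * ‖ev‖ := by positivity
    nlinarith
  · rw [mul_div_cancel_right₀ _ (Complex.exp_ne_zero _), sub_add_cancel]
    have hJd : ∀ x, HasDerivAt (fun x => (J x : ℂ)) ((J x : ℂ) - d x) x := fun x => by
      exact_mod_cast (H.hasDerivAt x).ofReal_comp
    have hJc : Continuous J := continuous_iff_continuousAt.2 fun x => (H.hasDerivAt x).continuousAt
    have hJM : ∀ x, ‖ev * (J x : ℂ)‖ ≤ ‖ev‖ * M := fun x => by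
      rw [norm_mul, Complex.norm_real]
      exact mul_le_mul_of_nonneg_left (H.abs_J_le x) hn
    -- The error `w - ev J` solves the linear equation with source `w² - (2μ - 1) ev J`. Both terms
    -- are `O(ev²)`, as `w` and `2μ - 1` are `O(ev)`.
    have h1 := norm_le_of_hasDerivAt_of_bounded (β := 2 * μ) (by linarith)
      (e := fun x => w x - ev * J x) (g := fun x => w x ^ 2 - (2 * μ - 1) * (ev * J x))
      (K := (4 * ‖ev‖ * M) ^ 2 + 4 * |p| * ‖ev‖ * (‖ev‖ * M)) (L := 4 * ‖ev‖ * M + ‖ev‖ * M)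
      (by fun_prop)
      (fun r => by
        refine (norm_sub_le _ _).trans (add_le_add ?_ ?_)
        · rw [norm_pow]; exact pow_le_pow_left₀ (norm_nonneg _) (hwM r) 2
        · rw [norm_mul]; exact mul_le_mul hμ1 (hJM r) (norm_nonneg _) (by positivity))
      (fun r => (norm_sub_le _ _).trans (add_le_add (hwM r) (hJM r)))
      (fun x => ((hw x).sub ((hJd x).const_mul ev)).congr_deriv (by ring)) x₀
    refine h1.trans ?_
    rw [div_le_iff₀ (by linarith)]
    have h2 : 0 ≤ (8 * |p| * M + 32 * M ^ 2) * ‖ev‖ ^ 2 := by positivity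
    have h3 : 0 ≤ A * ‖ev‖ ^ 2 := by positivity
    have h4 : 0 ≤ A * ‖ev‖ ^ 2 * (2 * μ).re := mul_nonneg h3 (by linarith)
    nlinarith [mul_le_mul_of_nonneg_left hβ h2]

/-! ### Uniqueness of the decaying solution -/

/-- A bound for the derivative in terms of bounds for a function and its second derivative. -/
theorem norm_deriv_le_of_norm_le {E : Type*} [NormedAddCommGroup E] [NormedSpace ℝ E]
    {f f' f'' : ℝ → E} {a A B : ℝ} (hf : ∀ x, HasDerivAt f (f' x) x)
    (hf' : ∀ x, HasDerivAt f' (f'' x) x) (hA : ∀ x, a ≤ x → ‖f x‖ ≤ A)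
    (hB : ∀ x, a ≤ x → ‖f'' x‖ ≤ B) (x : ℝ) (hx : a ≤ x) : ‖f' x‖ ≤ 2 * A + B := by
  have hB0 : 0 ≤ B := (norm_nonneg _).trans (hB x hx)
  have h1 : ∀ y ∈ Icc x (x + 1), ‖f' y - f' x‖ ≤ B := fun y hy => by
    have := (convex_Icc x (x + 1)).norm_image_sub_le_of_norm_hasDerivWithin_le
      (fun z _ => (hf' z).hasDerivWithinAt) (fun z hz => hB z (hx.trans hz.1))
      (left_mem_Icc.2 (by linarith)) hy
    refine this.trans (mul_le_of_le_one_right hB0 ?_)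
    rw [Real.norm_of_nonneg (by linarith [hy.1])]
    linarith [hy.2]
  have h2 : ∀ z, HasDerivAt (fun y => f y - y • f' x) (f' z - f' x) z := fun z => by
    exact ((hf z).sub ((hasDerivAt_id z).smul_const (f' x))).congr_deriv (by simp)
  have h3 := (convex_Icc x (x + 1)).norm_image_sub_le_of_norm_hasDerivWithin_le
    (fun z _ => (h2 z).hasDerivWithinAt) h1
    (left_mem_Icc.2 (by linarith)) (right_mem_Icc.2 (by linarith))
  have h4 : f' x = (f (x + 1) - f x) - (f (x + 1) - (x + 1) • f' x - (f x - x • f' x)) := by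
    rw [add_smul, one_smul]; abel
  have h5 : ‖x + 1 - x‖ = 1 := by simp
  rw [h5, mul_one] at h3
  rw [h4]
  have := norm_sub_le (f (x + 1) - f x) (f (x + 1) - (x + 1) • f' x - (f x - x • f' x))
  have := norm_sub_le (f (x + 1)) (f x)
  have := hA x hx
  have := hA (x + 1) (by linarith)
  linarith

/-- `φ'' = Q φ` on the line. -/
def IsSolution (Q φ : ℝ → ℂ) : Prop :=
  Differentiable ℝ φ ∧ Differentiable ℝ (deriv φ) ∧ ∀ x, deriv (deriv φ) x = Q x * φ x

theorem IsSolution.const_mul {Q φ : ℝ → ℂ} (h : IsSolution Q φ) (K : ℂ) :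
    IsSolution Q fun x => K * φ x := by
  have h1 : deriv (fun x => K * φ x) = fun x => K * deriv φ x :=
    funext fun x => deriv_const_mul K (h.1 x)
  refine ⟨h.1.const_mul K, ?_, fun x => ?_⟩
  · rw [h1]; exact h.2.1.const_mul K
  · rw [h1, deriv_const_mul K (h.2.1 x), h.2.2]; ring

theorem IsSolution.comp_neg {Q φ : ℝ → ℂ} (h : IsSolution Q φ) :
    IsSolution (fun x => Q (-x)) fun x => φ (-x) := by
  have h1 : deriv (fun x => φ (-x)) = fun x => -deriv φ (-x) := funext fun x => deriv_comp_neg φ x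
  refine ⟨h.1.comp differentiable_neg, ?_, fun x => ?_⟩
  · rw [h1]; exact (h.2.1.comp differentiable_neg).neg
  · rw [h1, deriv.fun_neg, deriv_comp_neg (deriv φ) x, h.2.2]; ring

/-- A bounded-coefficient equation has at most one solution asymptotic to `exp(-μ x)`, `Re μ > 0`. -/
theorem IsSolution.eq_of_tendsto {Q φ ψ : ℝ → ℂ} {μ : ℂ} {B : ℝ} (hφ : IsSolution Q φ)
    (hψ : IsSolution Q ψ) (hQ : ∀ x, ‖Q x‖ ≤ B) (hμ : 0 < μ.re) (hφ0 : ∀ x, φ x ≠ 0)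
    (hφ' : Tendsto (deriv φ) atTop (𝓝 0))
    (hφ1 : Tendsto (fun x : ℝ => Complex.exp (μ * x) * φ x) atTop (𝓝 1))
    (hψ1 : Tendsto (fun x : ℝ => Complex.exp (μ * x) * ψ x) atTop (𝓝 1)) : ψ = φ := by
  have hexp : Tendsto (fun x : ℝ => Complex.exp (-μ * x)) atTop (𝓝 0) := by
    rw [tendsto_zero_iff_norm_tendsto_zero]
    simp only [norm_exp_neg_mul_ofReal]
    exact Real.tendsto_exp_atBot.comp (tendsto_id.const_mul_atTop_of_neg (by linarith))
  have hzero : ∀ {f : ℝ → ℂ}, Tendsto (fun x : ℝ => Complex.exp (μ * x) * f x) atTop (𝓝 1) →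
      Tendsto f atTop (𝓝 0) := fun {f} hf => by
    have := hexp.mul hf
    rw [zero_mul] at this
    refine this.congr fun x => ?_
    rw [← mul_assoc, ← Complex.exp_add]; simp
  have hφz := hzero hφ1
  have hψz := hzero hψ1
  have hd : ∀ x, HasDerivAt ψ (deriv ψ x) x := fun x => (hψ.1 x).hasDerivAt
  have hdφ : ∀ x, HasDerivAt φ (deriv φ x) x := fun x => (hφ.1 x).hasDerivAt
  have hd2 : ∀ x, HasDerivAt (deriv ψ) (Q x * ψ x) x := fun x => by
    rw [← hψ.2.2]; exact (hψ.2.1 x).hasDerivAt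
  have hdφ2 : ∀ x, HasDerivAt (deriv φ) (Q x * φ x) x := fun x => by
    rw [← hφ.2.2]; exact (hφ.2.1 x).hasDerivAt
  have hB0 : 0 ≤ B := (norm_nonneg _).trans (hQ 0)
  obtain ⟨a, ha⟩ := eventually_atTop.1
    ((hψz.norm.eventually (gt_mem_nhds (show ‖(0 : ℂ)‖ < 1 by simp))))
  -- The normalization of `ψ` says nothing about `ψ'`; its boundedness comes by interpolation
  -- between `ψ` and `ψ'' = Q ψ`.
  have hbdd : ∀ x, a ≤ x → ‖deriv ψ x‖ ≤ 2 * 1 + B := norm_deriv_le_of_norm_le hd hd2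
    (fun x hx => (ha x hx).le) fun x hx => by
      rw [norm_mul]
      exact (mul_le_mul (hQ x) (ha x hx).le (norm_nonneg _) hB0).trans (by simp)
  -- The Wronskian is constant and tends to zero, so `ψ / φ` is constant, and the common
  -- normalization makes it one.
  have hW : ∀ x, HasDerivAt (fun x => φ x * deriv ψ x - deriv φ x * ψ x) 0 x := fun x =>
    (((hdφ x).mul (hd2 x)).sub ((hdφ2 x).mul (hd x))).congr_deriv (by ring)
  have hWlim : Tendsto (fun x => φ x * deriv ψ x - deriv φ x * ψ x) atTop (𝓝 0) := by
    have h1 : Tendsto (fun x => φ x * deriv ψ x) atTop (𝓝 0) :=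
      hφz.zero_mul_isBoundedUnder_le (isBoundedUnder_of_eventually_le (a := 2 * 1 + B)
        (eventually_atTop.2 ⟨a, hbdd⟩))
    simpa using h1.sub (hφ'.mul hψz)
  have hW0 : ∀ x, φ x * deriv ψ x - deriv φ x * ψ x = 0 := fun x => by
    refine tendsto_nhds_unique (tendsto_const_nhds.congr fun y => ?_) hWlim
    exact is_const_of_deriv_eq_zero (fun y => (hW y).differentiableAt) (fun y => (hW y).deriv) x y
  have hr : ∀ x, HasDerivAt (fun x => ψ x / φ x) 0 x := fun x => by
    refine ((hd x).div (hdφ x) (hφ0 x)).congr_deriv ?_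
    rw [show deriv ψ x * φ x - ψ x * deriv φ x = 0 by linear_combination hW0 x, zero_div]
  funext x
  have hc : ∀ y, ψ y = ψ x / φ x * φ y := fun y => by
    rw [← is_const_of_deriv_eq_zero (fun y => (hr y).differentiableAt) (fun y => (hr y).deriv) y x,
      div_mul_cancel₀ _ (hφ0 y)]
  have h1 : ψ x / φ x = 1 := by
    refine tendsto_nhds_unique ?_ hψ1
    have := hφ1.const_mul (ψ x / φ x)
    rw [mul_one] at this
    refine this.congr fun y => ?_
    rw [hc y]; ring
  rw [hc x, h1, one_mul]

/-- Uniqueness transfers the estimates from the constructed solution to Jost solutions that are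
given only by their characterization. -/
theorem IsTailPotential.existsUnique_decaying_solution {d J : ℝ → ℝ} {M : ℝ}
    (H : IsTailPotential d J M) (p x₀ : ℝ) :
    ∃ δ > 0, ∃ C : ℝ, ∀ ev μ : ℂ, ‖ev‖ < δ → 0 < μ.re → μ ^ 2 = 1 / 4 - ev * p →
      ∃ φ : ℝ → ℂ, IsSolution (fun x => 1 / 4 - ev * (p + d x)) φ ∧
        Tendsto (fun x : ℝ => Complex.exp (μ * x) * φ x) atTop (𝓝 1) ∧
        (∀ ψ : ℝ → ℂ, IsSolution (fun x => 1 / 4 - ev * (p + d x)) ψ →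
          Tendsto (fun x : ℝ => Complex.exp (μ * x) * ψ x) atTop (𝓝 1) → ψ = φ) ∧
        φ x₀ ≠ 0 ∧
        ‖Complex.exp (μ * x₀) * φ x₀ - 1‖ ≤ C * ‖ev‖ ∧
        ‖deriv φ x₀ / φ x₀ + μ - ev * J x₀‖ ≤ C * ‖ev‖ ^ 2 := by
  obtain ⟨δ, hδ, C, h⟩ := H.exists_decaying_solution p x₀
  refine ⟨δ, hδ, C, fun ev μ h1 h2 h3 => ?_⟩
  obtain ⟨φ, φ', h4, h5, h6, h7, h8, h9, h10⟩ := h ev μ h1 h2 h3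
  obtain rfl : deriv φ = φ' := funext fun x => (h4 x).deriv
  have hs : IsSolution (fun x => 1 / 4 - ev * (p + d x)) φ :=
    ⟨fun x => (h4 x).differentiableAt, fun x => (h5 x).differentiableAt, fun x => (h5 x).deriv⟩
  refine ⟨φ, hs, h7, fun ψ hψ hψ1 => ?_, h6 x₀, h9, h10⟩
  refine hs.eq_of_tendsto hψ (B := 1 / 4 + ‖ev‖ * (|p| + M)) (fun x => ?_) h2 h6 h8 h7 hψ1
  refine (norm_sub_le _ _).trans (add_le_add (by simp) ?_)
  rw [norm_mul]
  refine mul_le_mul_of_nonneg_left ((norm_add_le _ _).trans ?_) (norm_nonneg _)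
  rw [Complex.norm_real, Complex.norm_real]
  exact add_le_add le_rfl (H.abs_d_le x)

/-! ### Spatial profiles of step solutions -/

theorem exists_norm_le_of_tendsto {E : Type*} [NormedAddCommGroup E] {f : ℝ → E}
    (hf : Continuous f) {a b : E} (ha : Tendsto f atBot (𝓝 a)) (hb : Tendsto f atTop (𝓝 b)) :
    ∃ K, ∀ x, ‖f x‖ ≤ K := by
  obtain ⟨A, hA⟩ := eventually_atBot.1 (ha.norm.eventually_lt_const (lt_add_one ‖a‖))
  obtain ⟨B, hB⟩ := eventually_atTop.1 (hb.norm.eventually_lt_const (lt_add_one ‖b‖))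
  obtain ⟨K, hK⟩ := (isCompact_Icc (a := A) (b := B)).exists_bound_of_continuousOn hf.continuousOn
  refine ⟨max K (max (‖a‖ + 1) (‖b‖ + 1)), fun x => ?_⟩
  rcases le_total x A with h | h
  · exact (hA x h).le.trans ((le_max_left _ _).trans (le_max_right _ _))
  rcases le_total B x with h' | h'
  · exact (hB x h').le.trans ((le_max_right _ _).trans (le_max_right _ _))
  · exact (hK x ⟨h, h'⟩).trans (le_max_left _ _)

theorem exists_abs_le_of_integrable_deriv {f f' : ℝ → ℝ} (hf : ∀ x, HasDerivAt f (f' x) x)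
    (hi : Integrable f') : ∃ K, ∀ x, |f x| ≤ K := by
  refine ⟨|f 0| + ∫ x, ‖f' x‖, fun x => ?_⟩
  have h1 := intervalIntegral.integral_eq_sub_of_hasDerivAt (a := 0) (b := x) (fun y _ => hf y)
    hi.intervalIntegrable
  have h2 := intervalIntegral.norm_integral_le_integral_norm_uIoc (f := f') (a := 0) (b := x)
    (μ := volume)
  have h3 := setIntegral_le_integral (s := uIoc 0 x) hi.norm
    (Eventually.of_forall fun y => norm_nonneg (f' y))
  rw [h1] at h2
  have h4 := abs_add_le (f x - f 0) (f 0)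
  rw [sub_add_cancel] at h4
  rw [Real.norm_eq_abs] at h2
  linarith

/-- If `v - v'' = d`, then `J = v + v'` satisfies `J' = J - d`. Interpolation between `v` and `v''`
bounds `v'`, hence `J`. -/
theorem isTailPotential_of_bounded {v v' d : ℝ → ℝ} {A B : ℝ} (hv : ∀ x, HasDerivAt v (v' x) x)
    (hv' : ∀ x, HasDerivAt v' (v x - d x) x) (hd : Continuous d) (hA : ∀ x, |v x| ≤ A)
    (hB : ∀ x, |d x| ≤ B) (hi : IntegrableOn (fun x => (1 + |x|) * d x) (Ioi 0)) :
    ∃ M, IsTailPotential d (fun x => v x + v' x) M := by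
  have hA0 : 0 ≤ A := (abs_nonneg _).trans (hA 0)
  have hB0 : 0 ≤ B := (abs_nonneg _).trans (hB 0)
  have h1 : ∀ x, |v' x| ≤ 2 * A + (A + B) := fun x =>
    norm_deriv_le_of_norm_le (a := x) hv hv' (fun y _ => hA y)
      (fun y _ => (abs_sub _ _).trans (add_le_add (hA y) (hB y))) x le_rfl
  refine ⟨4 * A + B + 1, by positivity, hd, fun x => by linarith [hB x],
    fun x => ((hv x).add (hv' x)).congr_deriv (by ring),
    fun x => (abs_add_le _ _).trans (by linarith [hA x, h1 x]), ?_, ?_⟩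
  · refine Integrable.mono' hi.norm hd.abs.aestronglyMeasurable (Eventually.of_forall fun x => ?_)
    rw [Real.norm_eq_abs, abs_abs, Real.norm_eq_abs, abs_mul,
      abs_of_nonneg (a := 1 + |x|) (by positivity)]
    nlinarith [abs_nonneg x, abs_nonneg (d x)]
  · refine Integrable.mono' hi.norm (by fun_prop) (Eventually.of_forall fun x => ?_)
    rw [Real.norm_eq_abs, abs_mul, abs_abs, Real.norm_eq_abs, abs_mul,
      abs_of_nonneg (a := 1 + |x|) (by positivity)]
    nlinarith [abs_nonneg x, abs_nonneg (d x)]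

section StepSolution

variable {ω c : ℝ} {l : ℕ} {u : ℝ → ℝ → ℝ} {t : ℝ}

theorem IsStepSolution.hasDerivAt (hu : IsStepSolution ω c l u) (ht : 0 ≤ t) (x : ℝ) :
    HasDerivAt (fun ξ => u ξ t) (deriv (fun ξ => u ξ t) x) x :=
  ((hu.contDiff_x t ht).differentiable (by norm_num) x).hasDerivAt

theorem IsStepSolution.hasDerivAt_deriv (hu : IsStepSolution ω c l u) (ht : 0 ≤ t) (x : ℝ) :
    HasDerivAt (deriv fun ξ => u ξ t) (u x t - momentum u x t) x := by
  have h1 := ((hu.contDiff_x t ht).differentiable_iteratedDeriv 1 (by norm_num) x).hasDerivAt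
  rw [iteratedDeriv_one] at h1
  refine h1.congr_deriv ?_
  rw [momentum, iteratedDeriv_succ, iteratedDeriv_one]; ring

theorem IsStepSolution.contDiff_momentum (hu : IsStepSolution ω c l u) (ht : 0 ≤ t) :
    ContDiff ℝ 1 fun x => momentum u x t := by
  have h := hu.contDiff_x t ht
  refine (h.of_le (by norm_num)).sub ?_
  rw [iteratedDeriv_eq_iterate]
  exact ContDiff.iterate_deriv' 1 2 h

theorem IsStepSolution.continuous_momentum (hu : IsStepSolution ω c l u) (ht : 0 ≤ t) :
    Continuous fun x => momentum u x t :=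
  (hu.contDiff_momentum ht).continuous

theorem measurable_heaviside : Measurable heaviside :=
  Measurable.ite measurableSet_Ici measurable_const measurable_const

/-- The weight has exponent `l + 1 ≥ 1`, and one power of `1 + |x|` is all that the argument uses.
-/
theorem one_add_abs_mul_le_decayWeight (l : ℕ) (c : ℝ) (u : ℝ → ℝ → ℝ) (t x : ℝ) {y : ℝ}
    (hy : y ≤ |momentum u x t - c * heaviside (-x)|
      + |deriv (fun ξ => momentum u ξ t) x|) (hy0 : 0 ≤ y) :
    (1 + |x|) * y ≤ decayWeight l c u t x := by
  have h1 : 1 + |x| ≤ (1 + |x|) ^ (l + 1) :=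
    le_self_pow₀ (by linarith [abs_nonneg x]) (Nat.succ_ne_zero l)
  refine mul_le_mul h1 (hy.trans (le_add_of_nonneg_right (abs_nonneg _))) hy0 (by positivity)

theorem IsStepSolution.integrable_moment (hu : IsStepSolution ω c l u) (ht : 0 ≤ t) :
    Integrable fun x => (1 + |x|) * (momentum u x t - c * heaviside (-x)) := by
  obtain ⟨C, hC⟩ := hu.decay t ht
  have hm := (hu.continuous_momentum ht).measurable
  have hh : Measurable fun x => heaviside (-x) := measurable_heaviside.comp measurable_neg
  refine Integrable.mono' (hC t ⟨ht, le_rfl⟩).1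
    (Measurable.aestronglyMeasurable (by fun_prop)) (Eventually.of_forall fun x => ?_)
  rw [Real.norm_eq_abs, abs_mul, abs_of_nonneg (a := 1 + |x|) (by positivity)]
  exact one_add_abs_mul_le_decayWeight l c u t x (le_add_of_nonneg_right (abs_nonneg _))
    (abs_nonneg _)

theorem IsStepSolution.exists_abs_momentum_le (hu : IsStepSolution ω c l u) (ht : 0 ≤ t) :
    ∃ K, ∀ x, |momentum u x t| ≤ K := by
  obtain ⟨C, hC⟩ := hu.decay t ht
  have hm := hu.contDiff_momentum ht
  refine exists_abs_le_of_integrable_deriv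
    (fun x => (hm.differentiable (by norm_num) x).hasDerivAt)
    (Integrable.mono' (hC t ⟨ht, le_rfl⟩).1 (hm.continuous_deriv le_rfl).aestronglyMeasurable
      (Eventually.of_forall fun x => ?_))
  refine le_trans ?_ (one_add_abs_mul_le_decayWeight l c u t x
    (le_add_of_nonneg_left (abs_nonneg _)) (abs_nonneg _))
  rw [Real.norm_eq_abs]
  nlinarith [abs_nonneg x, abs_nonneg (deriv (fun ξ => momentum u ξ t) x)]

theorem IsStepSolution.exists_abs_le (hu : IsStepSolution ω c l u) (ht : 0 ≤ t) :
    ∃ K, ∀ x, |u x t| ≤ K :=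
  exists_norm_le_of_tendsto (hu.contDiff_x t ht).continuous (hu.tendsto_atBot t ht)
    (hu.tendsto_atTop t ht)

theorem IsStepSolution.integrableOn_momentum (hu : IsStepSolution ω c l u) (ht : 0 ≤ t) :
    IntegrableOn (fun x => (1 + |x|) * momentum u x t) (Ioi 0) := by
  refine ((hu.integrable_moment ht).integrableOn (s := Ioi 0)).congr_fun (fun x hx => ?_)
    measurableSet_Ioi
  have : ¬ 0 ≤ -x := by simpa using hx
  simp [heaviside, this]

theorem IsStepSolution.integrableOn_momentum_neg (hu : IsStepSolution ω c l u) (ht : 0 ≤ t) :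
    IntegrableOn (fun x => (1 + |x|) * (momentum u (-x) t - c)) (Ioi 0) := by
  refine ((hu.integrable_moment ht).comp_neg.integrableOn (s := Ioi 0)).congr_fun (fun x hx => ?_)
    measurableSet_Ioi
  have : 0 ≤ x := le_of_lt hx
  simp [heaviside, this]

/-- This is where `u` enters the spectral asymptotics: `u / ω` is the bounded solution of `v - v'' =
m / ω`. -/
theorem IsStepSolution.isTailPotential_right (hu : IsStepSolution ω c l u) (ht : 0 ≤ t) :
    ∃ M, IsTailPotential (fun x => momentum u x t / ω)
      (fun x => u x t / ω + deriv (fun ξ => u ξ t) x / ω) M := by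
  obtain ⟨A, hA⟩ := hu.exists_abs_le ht
  obtain ⟨B, hB⟩ := hu.exists_abs_momentum_le ht
  refine isTailPotential_of_bounded (A := A / |ω|) (B := B / |ω|)
    (fun x => (hu.hasDerivAt ht x).div_const ω)
    (fun x => ((hu.hasDerivAt_deriv ht x).div_const ω).congr_deriv (by ring))
    ((hu.continuous_momentum ht).div_const ω) (fun x => ?_) (fun x => ?_) ?_
  · rw [abs_div]; gcongr; exact hA x
  · rw [abs_div]; gcongr; exact hB x
  · simpa only [mul_div_assoc, IntegrableOn] using (hu.integrableOn_momentum ht).div_const ω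

/-- Reflection turns the left end into a right end with limit `c` subtracted. It also reverses the
sign of `u_x`, which causes the later cancellation. -/
theorem IsStepSolution.isTailPotential_left (hu : IsStepSolution ω c l u) (ht : 0 ≤ t) :
    ∃ M, IsTailPotential (fun x => (momentum u (-x) t - c) / ω)
      (fun x => (u (-x) t - c) / ω + -deriv (fun ξ => u ξ t) (-x) / ω) M := by
  obtain ⟨A, hA⟩ := hu.exists_abs_le ht
  obtain ⟨B, hB⟩ := hu.exists_abs_momentum_le ht
  have hneg : ∀ x : ℝ, HasDerivAt (fun x : ℝ => -x) (-1) x := fun x => (hasDerivAt_id x).neg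
  refine isTailPotential_of_bounded (A := (A + |c|) / |ω|) (B := (B + |c|) / |ω|)
    (fun x => ((((hu.hasDerivAt ht (-x)).comp x (hneg x)).sub_const c).div_const ω).congr_deriv
      (by ring))
    (fun x => ((((hu.hasDerivAt_deriv ht (-x)).comp x (hneg x)).neg).div_const ω).congr_deriv
      (by ring))
    ((((hu.continuous_momentum ht).comp continuous_neg).sub continuous_const).div_const ω)
    (fun x => ?_) (fun x => ?_) ?_
  · rw [abs_div]; gcongr; exact (abs_sub _ _).trans (add_le_add (hA _) le_rfl)
  · rw [abs_div]; gcongr; exact (abs_sub _ _).trans (add_le_add (hB _) le_rfl)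
  · simpa only [mul_div_assoc, IntegrableOn] using (hu.integrableOn_momentum_neg ht).div_const ω

end StepSolution

/-! ### The Jost solutions near `λ = 0` -/

variable {ω c : ℝ} {l : ℕ} {u : ℝ → ℝ → ℝ} {t : ℝ}

theorem ne_zero_of_div_pos (h : 0 < c / ω) : ω ≠ 0 := by
  rintro rfl
  simp at h

theorem one_lt_add_div (h : 0 < c / ω) : 1 < (c + ω) / ω := by
  rw [add_div, div_self (ne_zero_of_div_pos h)]; linarith

theorem add_ne_zero_of_div_pos (h : 0 < c / ω) : c + ω ≠ 0 := by
  intro h0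
  have := one_lt_add_div h
  rw [h0, zero_div] at this
  linarith

theorem solvesXEquation_iff (hp : ∀ x, 0 < (momentum u x t + ω) / ω) {k : ℂ}
    {φ : ℝ → ℂ} : SolvesXEquation ω u t k φ ↔
      IsSolution (fun x => 1 / 4 - lam k * (((momentum u x t + ω) / ω : ℝ) : ℂ)) φ := by
  refine and_congr_right fun _ => and_congr_right fun _ => forall_congr' fun x => ?_
  have h1 : (((momentum u x t + ω) / ω : ℝ) : ℂ) ≠ 0 := by exact_mod_cast (hp x).ne'
  have h2 : ((ω / (momentum u x t + ω) : ℝ) : ℂ) = ((((momentum u x t + ω) / ω : ℝ) : ℂ))⁻¹ := by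
    rw [← Complex.ofReal_inv, inv_div]
  rw [h2, inv_mul_eq_iff_eq_mul₀ h1]
  constructor <;> intro h <;> linear_combination -h

/-- The time factor does not depend on `x`. Absorbing it leaves the problem of the decaying solution
with `p = 1` and `μ = -ik`. -/
theorem isJostPlus_iff (hω : ω ≠ 0) (hp : ∀ x, 0 < (momentum u x t + ω) / ω) {k : ℂ}
    {φ : ℝ → ℂ} : IsJostPlus ω u t k φ ↔
      IsSolution (fun x => 1 / 4 - lam k * (((1 : ℝ) : ℂ) + ((momentum u x t / ω : ℝ) : ℂ)))
        (fun x => Complex.exp (Complex.I * ω * k * t / (2 * lam k)) * φ x) ∧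
      Tendsto (fun x : ℝ => Complex.exp (-Complex.I * k * x) *
        (Complex.exp (Complex.I * ω * k * t / (2 * lam k)) * φ x)) atTop (𝓝 1) := by
  have hQ : (fun x => 1 / 4 - lam k * (((1 : ℝ) : ℂ) + ((momentum u x t / ω : ℝ) : ℂ)))
      = fun x => 1 / 4 - lam k * (((momentum u x t + ω) / ω : ℝ) : ℂ) := by
    funext x
    rw [← Complex.ofReal_add, add_div, div_self hω, add_comm]
  rw [IsJostPlus, solvesXEquation_iff hp, hQ]
  refine and_congr ⟨fun h => h.const_mul _, fun h => ?_⟩ ?_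
  · have := h.const_mul (Complex.exp (Complex.I * ω * k * t / (2 * lam k)))⁻¹
    simpa only [inv_mul_cancel_left₀ (Complex.exp_ne_zero _)] using this
  · simp only [← mul_assoc, ← Complex.exp_add]

/-- First-order behaviour of the right Jost solution as `λ → 0`. -/
theorem IsStepSolution.jostPlus_estimates (hu : IsStepSolution ω c l u) (ht : 0 ≤ t)
    (hω : ω ≠ 0) (x : ℝ) :
    ∃ δ > 0, ∃ C : ℝ, ∀ k : ℂ, ‖lam k‖ < δ → 0 < k.im →
      jostPlus ω u x t k ≠ 0 ∧
      ‖Complex.exp (-Complex.I * k * x + Complex.I * ω * k * t / (2 * lam k)) *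
        jostPlus ω u x t k - 1‖ ≤ C * ‖lam k‖ ∧
      ‖deriv (fun ξ => jostPlus ω u ξ t k) x / jostPlus ω u x t k + -Complex.I * k
        - lam k * ((u x t / ω + deriv (fun ξ => u ξ t) x / ω : ℝ) : ℂ)‖ ≤ C * ‖lam k‖ ^ 2 := by
  obtain ⟨M, H⟩ := hu.isTailPotential_right ht
  obtain ⟨δ, hδ, C, h⟩ := H.existsUnique_decaying_solution 1 x
  have hp : ∀ x, 0 < (momentum u x t + ω) / ω := fun x => hu.positive x t ht
  refine ⟨δ, hδ, C, fun k hk hk0 => ?_⟩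
  obtain ⟨φ, h1, h2, h3, h4, h5, h6⟩ := h (lam k) (-Complex.I * k) hk (by simpa using hk0) (by
    rw [lam]; push_cast; linear_combination k ^ 2 * Complex.I_sq)
  set K := Complex.exp (Complex.I * ω * k * t / (2 * lam k)) with hK
  have hK0 : K ≠ 0 := Complex.exp_ne_zero _
  have hKφ : (fun x => K * (K⁻¹ * φ x)) = φ := by
    funext x; rw [mul_inv_cancel_left₀ hK0]
  have hex : IsJostPlus ω u t k fun x => K⁻¹ * φ x := by
    rw [isJostPlus_iff hω hp, ← hK, hKφ]
    refine ⟨h1, ?_⟩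
    simpa only [mul_inv_cancel_left₀ hK0] using h2
  -- Existence makes the chosen function a Jost solution; uniqueness then identifies it with `K⁻¹
  -- φ`.
  have hJ := (isJostPlus_iff hω hp).1 (Classical.epsilon_spec ⟨_, hex⟩)
  have hφ : ∀ y, φ y = K * jostPlus ω u y t k := fun y => (congrFun (h3 _ hJ.1 hJ.2) y).symm
  have hφ' : deriv φ x = K * deriv (fun ξ => jostPlus ω u ξ t k) x := by
    rw [show φ = fun y => K * jostPlus ω u y t k from funext hφ, deriv_const_mul_field]
  rw [hφ] at h4 h5
  rw [hφ, hφ', mul_div_mul_left _ _ hK0] at h6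
  refine ⟨right_ne_zero_of_mul h4, ?_, h6⟩
  rwa [Complex.exp_add, mul_assoc]

/-- The constant factor in the normalization of the left Jost solution. -/
noncomputable def minusFactor (ω c t : ℝ) (k : ℂ) : ℂ :=
  ((((c + ω) / ω) ^ (1 / 4 : ℝ) : ℝ) : ℂ) *
    Complex.exp (-(Complex.I * zOf ω c k * ((√((c + ω) / ω) : ℝ) : ℂ) *
      ((c + ω / (2 * lam k)) * t)))

theorem minusFactor_ne_zero (h : 0 < (c + ω) / ω) (t : ℝ) (k : ℂ) : minusFactor ω c t k ≠ 0 :=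
  mul_ne_zero (by exact_mod_cast (Real.rpow_pos_of_pos h _).ne') (Complex.exp_ne_zero _)

theorem minusFactor_mul_exp (k : ℂ) (x : ℝ) :
    minusFactor ω c t k * Complex.exp (Complex.I * zOf ω c k * ((√((c + ω) / ω) : ℝ) : ℂ) * x)
      = ((((c + ω) / ω) ^ (1 / 4 : ℝ) : ℝ) : ℂ) *
        Complex.exp (Complex.I * zOf ω c k * ((√((c + ω) / ω) : ℝ) : ℂ) *
          (x - (c + ω / (2 * lam k)) * t)) := by
  rw [minusFactor, mul_assoc, ← Complex.exp_add]
  ring_nf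

/-- After `x ↦ -x` this is again the decaying problem at `+∞`, now with `p = s² = (c+ω)/ω` and `μ =
-izs`. -/
theorem isJostMinus_iff (hp : ∀ x, 0 < (momentum u x t + ω) / ω)
    (hs : 0 < (c + ω) / ω) {k : ℂ} {φ : ℝ → ℂ} : IsJostMinus ω c u t k φ ↔
      IsSolution (fun x => 1 / 4 - lam k * ((((c + ω) / ω : ℝ) : ℂ)
          + (((momentum u (-x) t - c) / ω : ℝ) : ℂ)))
        (fun x => minusFactor ω c t k * φ (-x)) ∧
      Tendsto (fun x : ℝ => Complex.exp
        (-Complex.I * zOf ω c k * ((√((c + ω) / ω) : ℝ) : ℂ) * x) *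
        (minusFactor ω c t k * φ (-x))) atTop (𝓝 1) := by
  have hK := minusFactor_ne_zero hs t k
  have hQ : (fun x => 1 / 4 - lam k * ((((c + ω) / ω : ℝ) : ℂ)
          + (((momentum u (-x) t - c) / ω : ℝ) : ℂ)))
      = fun x => 1 / 4 - lam k * (((momentum u (-x) t + ω) / ω : ℝ) : ℂ) := by
    funext x
    rw [← Complex.ofReal_add, ← add_div]
    ring_nf
  rw [IsJostMinus, solvesXEquation_iff hp, hQ]
  refine and_congr ⟨fun h => h.comp_neg.const_mul _, fun h => ?_⟩ ?_
  · have := (h.const_mul (minusFactor ω c t k)⁻¹).comp_neg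
    simpa only [inv_mul_cancel_left₀ hK, neg_neg] using this
  · have h1 : (fun x : ℝ => ((((c + ω) / ω) ^ (1 / 4 : ℝ) : ℝ) : ℂ) *
        Complex.exp (Complex.I * zOf ω c k * ((√((c + ω) / ω) : ℝ) : ℂ) *
          (x - (c + ω / (2 * lam k)) * t)) * φ x) =
        (fun x : ℝ => Complex.exp
        (-Complex.I * zOf ω c k * ((√((c + ω) / ω) : ℝ) : ℂ) * x) *
        (minusFactor ω c t k * φ (-x))) ∘ Neg.neg := by
      funext x
      simp only [Function.comp, ← minusFactor_mul_exp, neg_neg]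
      push_cast
      ring_nf
    rw [h1, ← tendsto_map'_iff, map_neg_atBot]

/-- First-order behaviour of the left Jost solution as `λ → 0`. -/
theorem IsStepSolution.jostMinus_estimates (hu : IsStepSolution ω c l u) (ht : 0 ≤ t)
    (hcω : 0 < c / ω) (x : ℝ) :
    ∃ δ > 0, ∃ C : ℝ, ∀ k : ℂ, ‖lam k‖ < δ → 0 < (zOf ω c k).im →
      zOf ω c k ^ 2 = k ^ 2 + c / (4 * (c + ω)) →
      jostMinus ω c u x t k ≠ 0 ∧
      ‖minusFactor ω c t k *
          Complex.exp (Complex.I * zOf ω c k * ((√((c + ω) / ω) : ℝ) : ℂ) * x) *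
        jostMinus ω c u x t k - 1‖ ≤ C * ‖lam k‖ ∧
      ‖-(deriv (fun ξ => jostMinus ω c u ξ t k) x / jostMinus ω c u x t k)
        + -Complex.I * zOf ω c k * ((√((c + ω) / ω) : ℝ) : ℂ)
        - lam k * (((u x t - c) / ω + -deriv (fun ξ => u ξ t) x / ω : ℝ) : ℂ)‖
          ≤ C * ‖lam k‖ ^ 2 := by
  have hω := ne_zero_of_div_pos hcω
  have hs1 := one_lt_add_div hcω
  have hs : 0 < (c + ω) / ω := by linarith
  obtain ⟨M, H⟩ := hu.isTailPotential_left ht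
  obtain ⟨δ, hδ, C, h⟩ := H.existsUnique_decaying_solution ((c + ω) / ω) (-x)
  have hp : ∀ x, 0 < (momentum u x t + ω) / ω := fun x => hu.positive x t ht
  refine ⟨δ, hδ, C, fun k hk hz0 hz => ?_⟩
  have hcω' : (c : ℂ) + ω ≠ 0 := by exact_mod_cast add_ne_zero_of_div_pos hcω
  have hωC : (ω : ℂ) ≠ 0 := by exact_mod_cast hω
  have hssq : ((√((c + ω) / ω) : ℝ) : ℂ) ^ 2 = (c + ω) / ω := by
    rw [← Complex.ofReal_pow, Real.sq_sqrt hs.le]; push_cast; rfl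
  obtain ⟨φ, h1, h2, h3, h4, h5, h6⟩ := h (lam k)
    (-Complex.I * zOf ω c k * ((√((c + ω) / ω) : ℝ) : ℂ)) hk
    (by
      rw [Complex.re_mul_ofReal]
      have : 0 < √((c + ω) / ω) := Real.sqrt_pos.2 hs
      simpa using mul_pos hz0 this)
    -- Here `μ² = -z² s²`; since `z² = λ - 1/(4 s²)`, this equals `1/4 - λ s²`.
    (by
      rw [mul_pow, mul_pow, hssq, hz, neg_sq, Complex.I_sq, lam]
      push_cast
      field_simp
      ring)
  set K := minusFactor ω c t k with hK
  have hK0 : K ≠ 0 := minusFactor_ne_zero hs t k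
  have hKφ : (fun x => K * (K⁻¹ * φ x)) = φ := by
    funext x; rw [mul_inv_cancel_left₀ hK0]
  have hex : IsJostMinus ω c u t k fun x => K⁻¹ * φ (-x) := by
    rw [isJostMinus_iff hp hs, ← hK]
    simp only [neg_neg]
    rw [hKφ]
    refine ⟨h1, ?_⟩
    simpa only [mul_inv_cancel_left₀ hK0] using h2
  have hJ := (isJostMinus_iff hp hs).1 (Classical.epsilon_spec ⟨_, hex⟩)
  have hφ : ∀ y, φ y = K * jostMinus ω c u (-y) t k := fun y =>
    (congrFun (h3 _ hJ.1 hJ.2) y).symm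
  have hφ' : deriv φ (-x) = -(K * deriv (fun ξ => jostMinus ω c u ξ t k) x) := by
    rw [show φ = fun y => K * jostMinus ω c u (-y) t k from funext hφ, deriv_const_mul_field,
      deriv_comp_neg (fun y => jostMinus ω c u y t k), neg_neg]
    ring
  rw [hφ, neg_neg] at h4 h5
  rw [hφ, hφ', neg_neg, neg_div, mul_div_mul_left _ _ hK0] at h6
  refine ⟨right_ne_zero_of_mul h4, ?_, h6⟩
  refine le_trans (le_of_eq ?_) h5
  push_cast
  ring_nf

/-! ### The Liouville variable -/

theorem hasDerivAt_integral_Iic {E : Type*} [NormedAddCommGroup E] [NormedSpace ℝ E]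
    [CompleteSpace E] {f : ℝ → E} (hf : Continuous f) (hi : ∀ x, IntegrableOn f (Iic x))
    (x : ℝ) : HasDerivAt (fun x => ∫ r in Iic x, f r) (f x) x := by
  have h2 : (fun x => ∫ r in Iic x, f r) = fun y => (∫ r in x..y, f r) + ∫ r in Iic x, f r := by
    funext y
    rw [← intervalIntegral.integral_Iic_sub_Iic (hi x) (hi y), sub_add_cancel]
  rw [h2]
  simpa using (intervalIntegral.integral_hasDerivAt_right (hf.intervalIntegrable x x)
    (hf.stronglyMeasurableAtFilter _ _) hf.continuousAt).add_const (∫ r in Iic x, f r)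

theorem integrableOn_Iic_of_continuous {E : Type*} [NormedAddCommGroup E] {f : ℝ → E}
    (hf : Continuous f) {a : ℝ} (hi : IntegrableOn f (Iic a)) (b : ℝ) :
    IntegrableOn f (Iic b) := by
  refine ((hf.integrableOn_Icc (a := a) (b := b)).union hi).mono_set fun x hx => ?_
  rcases le_total x a with h | h
  · exact Or.inr h
  · exact Or.inl ⟨h, hx⟩

/-- Divide `a - b` by `√a + √b ≥ 1`. The asymptotic values `1` and `(c+ω)/ω` both satisfy `b ≥ 1`,
so no lower bound on `m + ω` is needed. -/
theorem abs_sqrt_sub_sqrt_le {a b : ℝ} (ha : 0 ≤ a) (hb : 1 ≤ b) : |√a - √b| ≤ |a - b| := by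
  have h1 : a - b = (√a - √b) * (√a + √b) := by
    have h2 := Real.sq_sqrt ha
    have h3 := Real.sq_sqrt (show 0 ≤ b by linarith)
    linear_combination h3 - h2
  have h2 : 1 ≤ √b := Real.one_le_sqrt.2 hb
  have h3 := Real.sqrt_nonneg a
  rw [h1, abs_mul, abs_of_nonneg (a := √a + √b) (by linarith)]
  exact le_mul_of_one_le_right (abs_nonneg _) (by linarith)

theorem IsStepSolution.continuous_sqrt (hu : IsStepSolution ω c l u) (ht : 0 ≤ t) :
    Continuous fun x => √((momentum u x t + ω) / ω) :=
  (((hu.continuous_momentum ht).add continuous_const).div_const ω).sqrt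

theorem IsStepSolution.integrableOn_sqrt_sub_one (hu : IsStepSolution ω c l u) (ht : 0 ≤ t)
    (hω : ω ≠ 0) (x : ℝ) :
    IntegrableOn (fun r => √((momentum u r t + ω) / ω) - 1) (Ioi x) := by
  have hc := (hu.continuous_sqrt ht).sub (continuous_const (y := (1 : ℝ)))
  refine integrableOn_Ioi_of_continuous hc (a := 0) ?_ x
  refine Integrable.mono' ((hu.integrableOn_momentum ht).norm.div_const |ω|)
    hc.aestronglyMeasurable (Eventually.of_forall fun r => ?_)
  have h1 := abs_sqrt_sub_sqrt_le (hu.positive r t ht).le le_rfl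
  have h2 : (momentum u r t + ω) / ω - 1 = momentum u r t / ω := by field_simp; ring
  rw [Real.sqrt_one, h2, abs_div] at h1
  rw [Real.norm_eq_abs]
  refine h1.trans ?_
  rw [Real.norm_eq_abs, abs_mul, abs_of_nonneg (a := 1 + |r|) (by positivity)]
  gcongr
  nlinarith [abs_nonneg r, abs_nonneg (momentum u r t)]

theorem IsStepSolution.integrableOn_sqrt_sub_sqrt (hu : IsStepSolution ω c l u) (ht : 0 ≤ t)
    (hcω : 0 < c / ω) (x : ℝ) :
    IntegrableOn (fun r => √((momentum u r t + ω) / ω) - √((c + ω) / ω)) (Iic x) := by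
  have hω := ne_zero_of_div_pos hcω
  have hc := (hu.continuous_sqrt ht).sub (continuous_const (y := √((c + ω) / ω)))
  refine integrableOn_Iic_of_continuous hc (a := 0) ?_ x
  refine Integrable.mono' ((hu.integrable_moment ht).norm.div_const |ω|).integrableOn
    hc.aestronglyMeasurable ((ae_restrict_iff' measurableSet_Iic).2
      (Eventually.of_forall fun r hr => ?_))
  have h1 := abs_sqrt_sub_sqrt_le (hu.positive r t ht).le (one_lt_add_div hcω).le
  have h2 : (momentum u r t + ω) / ω - (c + ω) / ω = (momentum u r t - c) / ω := by ring
  rw [h2, abs_div] at h1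
  rw [Real.norm_eq_abs]
  refine h1.trans ?_
  have h3 : heaviside (-r) = 1 := if_pos (by simpa using hr)
  rw [h3, mul_one, Real.norm_eq_abs, abs_mul, abs_of_nonneg (a := 1 + |r|) (by positivity)]
  gcongr
  nlinarith [abs_nonneg r, abs_nonneg (momentum u r t - c)]

theorem IsStepSolution.hasDerivAt_liouvilleY (hu : IsStepSolution ω c l u) (ht : 0 ≤ t)
    (hω : ω ≠ 0) (x : ℝ) :
    HasDerivAt (fun x => liouvilleY ω u x t) (√((momentum u x t + ω) / ω)) x :=
  ((hasDerivAt_id x).sub (hasDerivAt_integral_Ioi ((hu.continuous_sqrt ht).sub continuous_const)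
    (hu.integrableOn_sqrt_sub_one ht hω 0) x)).congr_deriv
    (by simp only [Pi.sub_apply]; ring)

theorem IsStepSolution.strictMono_liouvilleY (hu : IsStepSolution ω c l u) (ht : 0 ≤ t)
    (hω : ω ≠ 0) : StrictMono fun x => liouvilleY ω u x t :=
  strictMono_of_deriv_pos fun x => by
    rw [(hu.hasDerivAt_liouvilleY ht hω x).deriv]
    exact Real.sqrt_pos.2 (hu.positive x t ht)

/-- The integrals over `(x, ∞)` cancel, so `y + ℘` is the Liouville variable normalized at `-∞`. -/
theorem liouvilleY_add_wp (ω c : ℝ) (u : ℝ → ℝ → ℝ) (x t : ℝ) :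
    liouvilleY ω u x t + wp ω c u x t = √((c + ω) / ω) * x - c * √((c + ω) / ω) * t
      + ∫ r in Iic x, (√((momentum u r t + ω) / ω) - √((c + ω) / ω)) := by
  rw [liouvilleY, wp]; ring

theorem IsStepSolution.bijective_liouvilleY (hu : IsStepSolution ω c l u) (ht : 0 ≤ t)
    (hcω : 0 < c / ω) : Function.Bijective fun x => liouvilleY ω u x t := by
  have hω := ne_zero_of_div_pos hcω
  have hd := hu.hasDerivAt_liouvilleY ht hω
  refine ⟨(hu.strictMono_liouvilleY ht hω).injective, Continuous.surjective
    (continuous_iff_continuousAt.2 fun x => (hd x).continuousAt) ?_ ?_⟩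
  · have h0 : Tendsto (fun x => ∫ r in Ioi x, (√((momentum u r t + ω) / ω) - 1)) atTop (𝓝 0) :=
      tendsto_integral_Ioi_zero tendsto_id
    exact tendsto_id.atTop_add h0.neg
  · have h0 : Tendsto (fun x => ∫ r in Iic x, (√((momentum u r t + ω) / ω) - √((c + ω) / ω)))
        atBot (𝓝 0) := tendsto_integral_Iic_zero tendsto_id
    -- Near `-∞` the definition of `y` is not informative; `y` differs by a constant from `s x` plus
    -- an integral that vanishes there.
    have h1 : ∀ x, HasDerivAt (fun x => liouvilleY ω u x t - (√((c + ω) / ω) * x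
        + ∫ r in Iic x, (√((momentum u r t + ω) / ω) - √((c + ω) / ω)))) 0 x := fun x => by
      refine ((hd x).sub (((hasDerivAt_id x).const_mul _).add (hasDerivAt_integral_Iic
        ((hu.continuous_sqrt ht).sub continuous_const)
        (hu.integrableOn_sqrt_sub_sqrt ht hcω) x))).congr_deriv
        (by simp only [Pi.sub_apply]; ring)
    have h2 := fun x => is_const_of_deriv_eq_zero (fun y => (h1 y).differentiableAt)
      (fun y => (h1 y).deriv) x 0
    have h3 := ((tendsto_id (α := ℝ) (x := atBot)).const_mul_atBot
      (Real.sqrt_pos.2 (zero_lt_one.trans (one_lt_add_div hcω)))).atBot_add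
      (h0.add_const (liouvilleY ω u 0 t - (√((c + ω) / ω) * 0
        + ∫ r in Iic 0, (√((momentum u r t + ω) / ω) - √((c + ω) / ω)))))
    refine h3.congr fun x => ?_
    have := h2 x
    simp only [id]
    linarith

theorem sqrt_div_add_eq_inv (ω c : ℝ) : √(ω / (c + ω)) = (√((c + ω) / ω))⁻¹ := by
  rw [← Real.sqrt_inv, inv_div]

/-- The exponent in the ratio of the components of `V_l` at `z₀`. -/
theorem exponent_eq_integral (hcω : 0 < c / ω) (u : ℝ → ℝ → ℝ) (x t : ℝ) :
    √(ω / (c + ω)) * (liouvilleY ω u x t + wp ω c u x t) - x + c * t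
      = ∫ r in Iic x, (√((momentum u r t + ω) / (c + ω)) - 1) := by
  have hω := ne_zero_of_div_pos hcω
  have hcω' := add_ne_zero_of_div_pos hcω
  have hs := Real.sqrt_pos.2 (zero_lt_one.trans (one_lt_add_div hcω))
  have h1 : ∀ r, √((momentum u r t + ω) / (c + ω)) - 1
      = (√((c + ω) / ω))⁻¹ * (√((momentum u r t + ω) / ω) - √((c + ω) / ω)) := fun r => by
    have : (momentum u r t + ω) / (c + ω) = (momentum u r t + ω) / ω / ((c + ω) / ω) := by
      field_simp
    rw [this, Real.sqrt_div' _ (zero_lt_one.trans (one_lt_add_div hcω)).le, mul_sub,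
      inv_mul_cancel₀ hs.ne']
    ring
  simp only [h1]
  rw [integral_const_mul, sqrt_div_add_eq_inv, liouvilleY_add_wp]
  field_simp
  ring

/-! ### First-order expansions -/

section Expansion

variable {X : Type*} {F : Filter X}

/-- `μ² - (1/2 - p ε)² = -p² ε²`, and the factor `μ + 1/2 - p ε` tends to one because the limit of
`μ` selects the branch. -/
theorem isBigO_sqrt_expansion {ev μ : X → ℂ} {p : ℂ} (hev : Tendsto ev F (𝓝 0))
    (hμ : Tendsto μ F (𝓝 (1 / 2))) (h : ∀ᶠ ξ in F, μ ξ ^ 2 = 1 / 4 - p * ev ξ) :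
    (fun ξ => μ ξ - (1 / 2 - p * ev ξ)) =O[F] fun ξ => ev ξ ^ 2 := by
  have hd : Tendsto (fun ξ => μ ξ + 1 / 2 - p * ev ξ) F (𝓝 1) := by
    have := (hμ.add_const (1 / 2)).sub (hev.const_mul p)
    norm_num at this
    simpa using this
  have h1 : (fun ξ => (-p ^ 2 * ev ξ ^ 2) * (μ ξ + 1 / 2 - p * ev ξ)⁻¹)
      =O[F] fun ξ => ev ξ ^ 2 * 1 :=
    ((isBigO_refl (fun ξ => ev ξ ^ 2) F).const_mul_left (-p ^ 2)).mul
      ((hd.inv₀ one_ne_zero).isBigO_one ℂ)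
  simp only [mul_one] at h1
  refine h1.congr' ?_ EventuallyEq.rfl
  filter_upwards [h, hd.eventually_ne one_ne_zero] with ξ h2 h3
  rw [mul_inv_eq_iff_eq_mul₀ h3]
  linear_combination -h2

theorem isBigO_div_expansion {ev N D : X → ℂ} {a b : ℂ} (hev : Tendsto ev F (𝓝 0))
    (hN : (fun ξ => N ξ - (1 - a * ev ξ)) =O[F] fun ξ => ev ξ ^ 2)
    (hD : (fun ξ => D ξ - (1 - b * ev ξ)) =O[F] fun ξ => ev ξ ^ 2) :
    (fun ξ => N ξ / D ξ - (1 + (b - a) * ev ξ)) =O[F] fun ξ => ev ξ ^ 2 := by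
  have hev2 : Tendsto (fun ξ => ev ξ ^ 2) F (𝓝 0) := by simpa using hev.pow 2
  have hlin : ∀ e : ℂ, Tendsto (fun ξ => 1 + e * ev ξ) F (𝓝 1) := fun e => by
    simpa using (hev.const_mul e).const_add 1
  have hd : Tendsto D F (𝓝 1) := by
    have := (hD.trans_tendsto hev2).add (hlin (-b))
    rw [zero_add] at this
    exact this.congr fun ξ => by ring
  have h1 := (hD.mul ((hlin (b - a)).isBigO_one ℂ))
  simp only [mul_one] at h1
  have h2 := ((hN.sub h1).add
    ((isBigO_refl (fun ξ => ev ξ ^ 2) F).const_mul_left (b * (b - a)))).mul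
      ((hd.inv₀ one_ne_zero).isBigO_one ℂ)
  simp only [mul_one] at h2
  refine h2.congr' ?_ EventuallyEq.rfl
  filter_upwards [hd.eventually_ne one_ne_zero] with ξ h3
  field_simp
  ring

end Expansion

/-- Filling in a removable singularity of a pair of functions of which one has a nonzero limit and
the product has a first-order expansion. -/
theorem fillIn_expansion {S : Set ℂ} {F : ℂ → ℂ × ℂ} {k₀ A B α : ℂ} (hk₀ : k₀ ∈ S)
    (hS : ∀ᶠ k in 𝓝[≠] k₀, k ∉ S) (hA : A ≠ 0) (hB : B ≠ 0)
    (h2 : Tendsto (fun k => (F k).2) (𝓝[≠] k₀) (𝓝 B))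
    (hexp : (fun k => (F k).1 * (F k).2 - A * (1 + α * (k - k₀)))
      =O[𝓝[≠] k₀] fun k => (k - k₀) ^ 2) :
    ContinuousAt (fillIn S F) k₀ ∧ (fillIn S F k₀).2 ≠ 0 ∧
      (fillIn S F k₀).1 / (fillIn S F k₀).2 = A / B ^ 2 ∧
      (fun k => (fillIn S F k).1 * (fillIn S F k).2 - A * (1 + α * (k - k₀)))
        =O[𝓝 k₀] (fun k => (k - k₀) ^ 2) ∧
      deriv (fun k => (fillIn S F k).1 * (fillIn S F k).2) k₀
        / ((fillIn S F k₀).1 * (fillIn S F k₀).2) = α := by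
  have hsub : Tendsto (fun k : ℂ => k - k₀) (𝓝[≠] k₀) (𝓝 0) := by
    have : Tendsto (fun k : ℂ => k - k₀) (𝓝 k₀) (𝓝 (k₀ - k₀)) :=
      (continuous_id.sub continuous_const).tendsto k₀
    rw [sub_self] at this
    exact this.mono_left nhdsWithin_le_nhds
  have hsq : Tendsto (fun k : ℂ => (k - k₀) ^ 2) (𝓝[≠] k₀) (𝓝 0) := by simpa using hsub.pow 2
  have hprod : Tendsto (fun k => (F k).1 * (F k).2) (𝓝[≠] k₀) (𝓝 A) := by
    have := (hexp.trans_tendsto hsq).add (((hsub.const_mul α).const_add 1).const_mul A)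
    simp only [mul_zero, add_zero, mul_one, zero_add, sub_add_cancel] at this
    exact this
  -- The first component needs no separate analysis: it is the product divided by the second
  -- component.
  have h1 : Tendsto (fun k => (F k).1) (𝓝[≠] k₀) (𝓝 (A / B)) := by
    refine (hprod.div h2 hB).congr' ?_
    filter_upwards [h2.eventually_ne hB] with k hk
    exact mul_div_cancel_right₀ _ hk
  have hlim : Tendsto F (𝓝[≠] k₀) (𝓝 (A / B, B)) := h1.prodMk_nhds h2
  have hval : fillIn S F k₀ = (A / B, B) := by
    rw [fillIn, if_pos hk₀, hlim.limUnder_eq]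
  have heq : fillIn S F =ᶠ[𝓝[≠] k₀] F := hS.mono fun k hk => if_neg hk
  have hbig : (fun k => (fillIn S F k).1 * (fillIn S F k).2 - A * (1 + α * (k - k₀)))
        =O[𝓝 k₀] (fun k => (k - k₀) ^ 2) := by
    rw [← nhdsNE_sup_pure, isBigO_sup]
    refine ⟨hexp.congr' (heq.mono fun k hk => by simp only [hk]) EventuallyEq.rfl, ?_⟩
    rw [isBigO_pure]
    intro _
    rw [hval]
    simp [div_mul_cancel₀ A hB]
  refine ⟨?_, by rw [hval]; exact hB, by rw [hval]; field_simp, hbig, ?_⟩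
  · rw [continuousAt_iff_punctured_nhds, hval]
    exact hlim.congr' heq.symm
  · have hder : HasDerivAt (fun k => (fillIn S F k).1 * (fillIn S F k).2) (A * α) k₀ := by
      rw [hasDerivAt_iff_isLittleO]
      refine IsBigO.trans_isLittleO (hbig.congr_left fun k => ?_) ?_
      · rw [hval, div_mul_cancel₀ A hB, smul_eq_mul]; ring
      · simpa only [← norm_pow, isLittleO_norm_left] using isLittleO_pow_sub_sub k₀ one_lt_two
    rw [hder.deriv, hval, div_mul_cancel₀ A hB, mul_div_cancel_left₀ _ hA]

/-- Behaviour of the Jost solutions and of the diagonal of the Green function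
along a spectral parameter `k` for which `λ → 0`. -/
theorem IsStepSolution.jost_asymptotics (hu : IsStepSolution ω c l u) (ht : 0 ≤ t)
    (hcω : 0 < c / ω) (x : ℝ) {X : Type*} {F : Filter X} {k : X → ℂ}
    (hk : Tendsto k F (𝓝 (Complex.I / 2)))
    (hz : Tendsto (fun ξ => zOf ω c (k ξ)) F (𝓝 (Complex.I / 2 * ((√(ω / (c + ω)) : ℝ) : ℂ))))
    (hzk : ∀ᶠ ξ in F, zOf ω c (k ξ) ^ 2 = k ξ ^ 2 + c / (4 * (c + ω))) :
    Tendsto (fun ξ => Complex.exp (-Complex.I * k ξ * x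
        + Complex.I * ω * k ξ * t / (2 * lam (k ξ))) * jostPlus ω u x t (k ξ)) F (𝓝 1) ∧
      Tendsto (fun ξ => minusFactor ω c t (k ξ) *
          Complex.exp (Complex.I * zOf ω c (k ξ) * ((√((c + ω) / ω) : ℝ) : ℂ) * x) *
        jostMinus ω c u x t (k ξ)) F (𝓝 1) ∧
      (fun ξ => 2 * Complex.I * k ξ * (jostMinus ω c u x t (k ξ) * jostPlus ω u x t (k ξ)
          / wronskian ω c u x t (k ξ)) - (1 + 2 * u x t / ω * lam (k ξ)))
        =O[F] (fun ξ => lam (k ξ) ^ 2) ∧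
      (fun ξ => 2 * Complex.I * zOf ω c (k ξ) * ((√((c + ω) / ω) : ℝ) : ℂ) *
          (jostMinus ω c u x t (k ξ) * jostPlus ω u x t (k ξ)
          / wronskian ω c u x t (k ξ)) - (1 + 2 * (u x t - c) / ω * lam (k ξ)))
        =O[F] (fun ξ => lam (k ξ) ^ 2) := by
  have hω := ne_zero_of_div_pos hcω
  have hωC : (ω : ℂ) ≠ 0 := by exact_mod_cast hω
  have hcωC : (c : ℂ) + ω ≠ 0 := by exact_mod_cast add_ne_zero_of_div_pos hcω
  have hs0 : 0 < (c + ω) / ω := zero_lt_one.trans (one_lt_add_div hcω)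
  set s : ℝ := √((c + ω) / ω) with hs
  have hsp : 0 < s := Real.sqrt_pos.2 hs0
  have hssq : (s : ℂ) ^ 2 = (c + ω) / ω := by
    rw [← Complex.ofReal_pow, Real.sq_sqrt hs0.le]; push_cast; rfl
  have hsC : (s : ℂ) ≠ 0 := by exact_mod_cast hsp.ne'
  rw [sqrt_div_add_eq_inv, ← hs] at hz
  have hev : Tendsto (fun ξ => lam (k ξ)) F (𝓝 0) := by
    have := (hk.pow 2).add_const (1 / 4)
    rw [div_pow, Complex.I_sq] at this
    norm_num at this
    exact this.congr fun ξ => by rw [lam]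
  have hevn : Tendsto (fun ξ => ‖lam (k ξ)‖) F (𝓝 0) := by simpa using hev.norm
  obtain ⟨δ₁, hδ₁, C₁, hplus⟩ := hu.jostPlus_estimates ht hω x
  obtain ⟨δ₂, hδ₂, C₂, hminus⟩ := hu.jostMinus_estimates ht hcω x
  have hkim : ∀ᶠ ξ in F, 0 < (k ξ).im :=
    ((Complex.continuous_im.tendsto _).comp hk).eventually_const_lt (by simp)
  have hzim : ∀ᶠ ξ in F, 0 < (zOf ω c (k ξ)).im :=
    ((Complex.continuous_im.tendsto _).comp hz).eventually_const_lt
      (by rw [Complex.im_mul_ofReal]; simpa using hsp)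
  have hP := ((hevn.eventually_lt_const hδ₁).and hkim).mono fun ξ h => hplus (k ξ) h.1 h.2
  have hM := ((hevn.eventually_lt_const hδ₂).and (hzim.and hzk)).mono
    fun ξ h => hminus (k ξ) h.1 h.2.1 h.2.2
  have htend : ∀ {f : X → ℂ} {C : ℝ}, (∀ᶠ ξ in F, ‖f ξ - 1‖ ≤ C * ‖lam (k ξ)‖) →
      Tendsto f F (𝓝 1) := fun {f C} hf => by
    have h0 : Tendsto (fun ξ => C * ‖lam (k ξ)‖) F (𝓝 0) := by simpa using hevn.const_mul C
    exact tendsto_iff_norm_sub_tendsto_zero.2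
      (squeeze_zero' (Eventually.of_forall fun _ => norm_nonneg _) hf h0)
  refine ⟨htend (hP.mono fun ξ h => h.2.1), htend (hM.mono fun ξ h => h.2.1), ?_⟩
  have hO1 : (fun ξ => deriv (fun ξ' => jostPlus ω u ξ' t (k ξ)) x / jostPlus ω u x t (k ξ)
      + -Complex.I * k ξ - lam (k ξ) * ((u x t / ω + deriv (fun ξ => u ξ t) x / ω : ℝ) : ℂ))
      =O[F] fun ξ => lam (k ξ) ^ 2 :=
    IsBigO.of_bound C₁ (hP.mono fun ξ h => by rw [norm_pow]; exact h.2.2)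
  have hO2 : (fun ξ => -(deriv (fun ξ' => jostMinus ω c u ξ' t (k ξ)) x
      / jostMinus ω c u x t (k ξ)) + -Complex.I * zOf ω c (k ξ) * s
      - lam (k ξ) * (((u x t - c) / ω + -deriv (fun ξ => u ξ t) x / ω : ℝ) : ℂ))
      =O[F] fun ξ => lam (k ξ) ^ 2 :=
    IsBigO.of_bound C₂ (hM.mono fun ξ h => by rw [norm_pow]; exact h.2.2)
  have hμ₁ : Tendsto (fun ξ => -Complex.I * k ξ) F (𝓝 (1 / 2)) := by
    have := hk.const_mul (-Complex.I)
    rwa [show -Complex.I * (Complex.I / 2) = 1 / 2 by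
      linear_combination (-1 / 2) * Complex.I_sq] at this
  have hμ₂ : Tendsto (fun ξ => -Complex.I * zOf ω c (k ξ) * s) F (𝓝 (1 / 2)) := by
    have := (hz.const_mul (-Complex.I)).mul_const (s : ℂ)
    rwa [show -Complex.I * (Complex.I / 2 * ((s⁻¹ : ℝ) : ℂ)) * s = 1 / 2 by
      push_cast; field_simp; linear_combination -Complex.I_sq] at this
  have hE1 := isBigO_sqrt_expansion (p := 1) hev hμ₁ (Eventually.of_forall fun ξ => by
    rw [lam]; linear_combination k ξ ^ 2 * Complex.I_sq)
  have hE2 := isBigO_sqrt_expansion (p := (c + ω) / ω) hev hμ₂ (hzk.mono fun ξ h => by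
    rw [mul_pow, mul_pow, hssq, h, neg_sq, Complex.I_sq, lam]
    field_simp
    ring)
  -- `-D` is the Wronskian divided by `φ₋ φ₊`. In the sum of the four expansions `u_x` and `c`
  -- cancel, leaving `D = 1 - (2 + 2u/ω) λ + O(λ²)`.
  set D : X → ℂ := fun ξ => -(deriv (fun ξ' => jostPlus ω u ξ' t (k ξ)) x / jostPlus ω u x t (k ξ)
    - deriv (fun ξ' => jostMinus ω c u ξ' t (k ξ)) x / jostMinus ω c u x t (k ξ)) with hDdef
  have hD : (fun ξ => D ξ - (1 - (2 + 2 * u x t / ω) * lam (k ξ))) =O[F]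
      fun ξ => lam (k ξ) ^ 2 := by
    refine (((hE1.add hE2).sub hO1).sub hO2).congr_left fun ξ => ?_
    rw [hDdef]
    push_cast
    field_simp
    ring
  have hG : ∀ᶠ ξ in F, jostMinus ω c u x t (k ξ) * jostPlus ω u x t (k ξ)
      / wronskian ω c u x t (k ξ) = -(D ξ)⁻¹ := by
    filter_upwards [hP, hM] with ξ h1 h2
    have e : wronskian ω c u x t (k ξ)
        = -(jostMinus ω c u x t (k ξ) * jostPlus ω u x t (k ξ) * D ξ) := by
      have := h1.1
      have := h2.1
      rw [wronskian, hDdef]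
      field_simp
    rw [e, div_neg, div_mul_cancel_left₀ (mul_ne_zero h2.1 h1.1)]
  constructor
  · refine (isBigO_div_expansion (N := fun ξ => 2 * (-Complex.I * k ξ)) (a := 2) hev
      ((hE1.const_mul_left 2).congr_left fun ξ => by ring) hD).congr' ?_ EventuallyEq.rfl
    filter_upwards [hG] with ξ h
    rw [h]
    ring
  -- Now the numerator is `1 - 2 s² λ + O(λ²)`; since `s² = 1 + c/ω`, the quotient contains `u - c`
  -- in place of `u`.
  · refine (isBigO_div_expansion (N := fun ξ => 2 * (-Complex.I * zOf ω c (k ξ) * s))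
      (a := 2 * ((c + ω) / ω)) hev
      ((hE2.const_mul_left 2).congr_left fun ξ => by ring) hD).congr' ?_ EventuallyEq.rfl
    filter_upwards [hG] with ξ h
    rw [h]
    field_simp
    ring

/-! ### The spectral parameters near `λ = 0` -/

theorem mul_cpow_half_sq {k a : ℂ} (hk : k ≠ 0) :
    (k * (1 + a / k ^ 2) ^ (1 / 2 : ℂ)) ^ 2 = k ^ 2 + a := by
  have h : ((1 + a / k ^ 2) ^ (1 / 2 : ℂ)) ^ 2 = 1 + a / k ^ 2 := by
    have := Complex.cpow_nat_inv_pow (1 + a / k ^ 2) two_ne_zero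
    rwa [show (((2 : ℕ) : ℂ))⁻¹ = 1 / 2 by norm_num] at this
  rw [mul_pow, h]
  field_simp

theorem continuousAt_mul_cpow_half {k₀ a : ℂ} (hk : k₀ ≠ 0)
    (h : 1 + a / k₀ ^ 2 ∈ Complex.slitPlane) :
    ContinuousAt (fun k : ℂ => k * (1 + a / k ^ 2) ^ (1 / 2 : ℂ)) k₀ := by
  refine continuousAt_id.mul (ContinuousAt.cpow ?_ continuousAt_const h)
  exact continuousAt_const.add (continuousAt_const.div (continuousAt_id.pow 2) (pow_ne_zero 2 hk))

theorem ofReal_cpow_half {a : ℝ} (ha : 0 ≤ a) : (a : ℂ) ^ (1 / 2 : ℂ) = ((√a : ℝ) : ℂ) := by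
  rw [Real.sqrt_eq_rpow, Complex.ofReal_cpow ha]
  norm_num

theorem zOf_sq (ω c : ℝ) {k : ℂ} (hk : k ≠ 0) : zOf ω c k ^ 2 = k ^ 2 + c / (4 * (c + ω)) :=
  mul_cpow_half_sq hk

theorem kOf_eq (ω c : ℝ) (z : ℂ) :
    kOf ω c z = z * (1 + (-(c / (4 * (c + ω)) : ℂ)) / z ^ 2) ^ (1 / 2 : ℂ) := by
  rw [kOf, neg_div, sub_eq_add_neg]

theorem kOf_sq (ω c : ℝ) {z : ℂ} (hz : z ≠ 0) : kOf ω c z ^ 2 = z ^ 2 - c / (4 * (c + ω)) := by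
  rw [kOf_eq, mul_cpow_half_sq hz, sub_eq_add_neg]

/-- At `k = i/2` the radicand is a positive real, away from the cut, so `z(k)` is continuous there.
-/
theorem base_zOf (hcω : 0 < c / ω) : (1 + (c / (4 * (c + ω)) : ℂ) / (Complex.I / 2) ^ 2)
    = ((ω / (c + ω) : ℝ) : ℂ) := by
  have h : (c : ℂ) + ω ≠ 0 := by exact_mod_cast add_ne_zero_of_div_pos hcω
  rw [div_pow, Complex.I_sq]
  push_cast
  field_simp
  ring

theorem z₀_sq (hcω : 0 < c / ω) :
    (Complex.I / 2 * ((√(ω / (c + ω)) : ℝ) : ℂ)) ^ 2 = -((ω / (4 * (c + ω)) : ℝ) : ℂ) := by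
  have h1 : 0 < ω / (c + ω) := by
    rw [← inv_div]; exact inv_pos.2 (zero_lt_one.trans (one_lt_add_div hcω))
  have h : (c : ℂ) + ω ≠ 0 := by exact_mod_cast add_ne_zero_of_div_pos hcω
  rw [mul_pow, div_pow, Complex.I_sq, ← Complex.ofReal_pow, Real.sq_sqrt h1.le]
  push_cast
  field_simp
  ring

theorem base_kOf (hcω : 0 < c / ω) : (1 + (-(c / (4 * (c + ω)) : ℂ)) /
    (Complex.I / 2 * ((√(ω / (c + ω)) : ℝ) : ℂ)) ^ 2) = (((c + ω) / ω : ℝ) : ℂ) := by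
  have h : (c : ℂ) + ω ≠ 0 := by exact_mod_cast add_ne_zero_of_div_pos hcω
  have h2 : (ω : ℂ) ≠ 0 := by exact_mod_cast ne_zero_of_div_pos hcω
  rw [z₀_sq hcω]
  push_cast
  field_simp
  ring

theorem div_add_pos (hcω : 0 < c / ω) : 0 < ω / (c + ω) := by
  rw [← inv_div]; exact inv_pos.2 (zero_lt_one.trans (one_lt_add_div hcω))

theorem tendsto_zOf (hcω : 0 < c / ω) : Tendsto (zOf ω c) (𝓝 (Complex.I / 2))
    (𝓝 (Complex.I / 2 * ((√(ω / (c + ω)) : ℝ) : ℂ))) := by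
  have h := continuousAt_mul_cpow_half (k₀ := Complex.I / 2) (a := c / (4 * (c + ω)))
    (by simp) (by rw [base_zOf hcω, Complex.ofReal_mem_slitPlane]; exact div_add_pos hcω)
  rw [ContinuousAt, base_zOf hcω, ofReal_cpow_half (div_add_pos hcω).le] at h
  exact h

theorem z₀_ne_zero (hcω : 0 < c / ω) : Complex.I / 2 * ((√(ω / (c + ω)) : ℝ) : ℂ) ≠ 0 :=
  mul_ne_zero (by simp) (by exact_mod_cast (Real.sqrt_pos.2 (div_add_pos hcω)).ne')

theorem tendsto_kOf (hcω : 0 < c / ω) :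
    Tendsto (kOf ω c) (𝓝 (Complex.I / 2 * ((√(ω / (c + ω)) : ℝ) : ℂ))) (𝓝 (Complex.I / 2)) := by
  have hs := zero_lt_one.trans (one_lt_add_div hcω)
  have h := continuousAt_mul_cpow_half (k₀ := Complex.I / 2 * ((√(ω / (c + ω)) : ℝ) : ℂ))
    (a := -(c / (4 * (c + ω)))) (z₀_ne_zero hcω)
    (by rw [base_kOf hcω, Complex.ofReal_mem_slitPlane]; exact hs)
  have h1 : ((√(ω / (c + ω)) : ℝ) : ℂ) * ((√((c + ω) / ω) : ℝ) : ℂ) = 1 := by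
    rw [sqrt_div_add_eq_inv, ← Complex.ofReal_mul, inv_mul_cancel₀ (Real.sqrt_pos.2 hs).ne',
      Complex.ofReal_one]
  rw [ContinuousAt, base_kOf hcω, ofReal_cpow_half hs.le, mul_assoc, h1, mul_one] at h
  exact h.congr fun z => (kOf_eq ω c z).symm

/-- The squares of both sides agree, and their sum is near `2 z₀ ≠ 0`, which excludes the opposite
sign. -/
theorem eventually_zOf_kOf (hcω : 0 < c / ω) :
    ∀ᶠ z in 𝓝 (Complex.I / 2 * ((√(ω / (c + ω)) : ℝ) : ℂ)), zOf ω c (kOf ω c z) = z := by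
  have h0 := z₀_ne_zero hcω
  have h1 := (tendsto_zOf hcω).comp (tendsto_kOf hcω)
  have h2 := (h1.add tendsto_id).eventually_ne
    (show _ ≠ (0 : ℂ) by rw [← two_mul]; exact mul_ne_zero two_ne_zero h0)
  filter_upwards [h2, (tendsto_kOf hcω).eventually_ne (show Complex.I / 2 ≠ 0 by simp),
    eventually_ne_nhds h0] with z h3 h4 h5
  have h6 : (zOf ω c (kOf ω c z) - z) * (zOf ω c (kOf ω c z) + z) = 0 := by
    linear_combination zOf_sq ω c h4 + kOf_sq ω c h5
  exact sub_eq_zero.1 ((mul_eq_zero.1 h6).resolve_right h3)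

theorem eventually_sq_ne {k₀ a : ℂ} (hk₀ : k₀ ≠ 0) (ha : k₀ ^ 2 = -a) :
    ∀ᶠ k in 𝓝[≠] k₀, k ^ 2 + a ≠ 0 := by
  have h1 : ∀ᶠ k in 𝓝 k₀, k + k₀ ≠ 0 :=
    (continuous_id.add continuous_const).continuousAt.eventually_ne
      (show id k₀ + k₀ ≠ 0 by rw [id, ← two_mul]; exact mul_ne_zero two_ne_zero hk₀)
  filter_upwards [h1.filter_mono nhdsWithin_le_nhds, self_mem_nhdsWithin] with k h2 h3 h4
  have : (k - k₀) * (k + k₀) = 0 := by linear_combination h4 - ha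
  exact (mul_eq_zero.1 this).elim (fun h => h3 (sub_eq_zero.1 h)) h2

theorem liouvilleFactor_sq (hp : 0 < (momentum u x t + ω) / ω) :
    liouvilleFactor ω u x t ^ 2 = ((√((momentum u x t + ω) / ω) : ℝ) : ℂ) := by
  rw [liouvilleFactor, ← Complex.ofReal_pow, ← Real.rpow_natCast, ← Real.rpow_mul hp.le,
    Real.sqrt_eq_rpow]
  norm_num

theorem rpow_quarter_sq {a : ℝ} (ha : 0 ≤ a) : (((a ^ (1 / 4 : ℝ) : ℝ)) : ℂ) ^ 2 = ((√a : ℝ) : ℂ) := by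
  rw [← Complex.ofReal_pow, ← Real.rpow_natCast, ← Real.rpow_mul ha, Real.sqrt_eq_rpow]
  norm_num

/-! ### The two recovery formulas -/

/-- The second component involves only `φ₊`, and `a₊` enters the product only through `φ₋ φ₊ / W`.
-/
theorem IsStepSolution.right_expansion (hu : IsStepSolution ω c l u) (ht : 0 ≤ t)
    (hcω : 0 < c / ω) (x : ℝ) :
    Tendsto (fun k => (formulaVr ω c u x t k).2) (𝓝[≠] (Complex.I / 2))
      (𝓝 (liouvilleFactor ω u x t * Complex.exp (-((x - liouvilleY ω u x t : ℝ) : ℂ) / 2))) ∧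
    (fun k => (formulaVr ω c u x t k).1 * (formulaVr ω c u x t k).2
        - ((√((momentum u x t + ω) / ω) : ℝ) : ℂ) *
          (1 + 2 * Complex.I / ω * u x t * (k - Complex.I / 2)))
      =O[𝓝[≠] (Complex.I / 2)] fun k => (k - Complex.I / 2) ^ 2 := by
  have hid : Tendsto (fun k : ℂ => k) (𝓝[≠] (Complex.I / 2)) (𝓝 (Complex.I / 2)) :=
    tendsto_id.mono_left nhdsWithin_le_nhds
  have hz := (tendsto_zOf hcω).comp hid
  have hk0 := hid.eventually_ne (show Complex.I / 2 ≠ 0 by simp)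
  have hzim : ∀ᶠ k in 𝓝[≠] (Complex.I / 2), 0 < (zOf ω c k).im :=
    ((Complex.continuous_im.tendsto _).comp hz).eventually_const_lt (by
      rw [Complex.im_mul_ofReal]; simpa using Real.sqrt_pos.2 (div_add_pos hcω))
  have hlam : ∀ᶠ k in 𝓝[≠] (Complex.I / 2), lam k ≠ 0 :=
    eventually_sq_ne (by simp) (by rw [div_pow, Complex.I_sq]; norm_num)
  obtain ⟨h1, -, h3, -⟩ := hu.jost_asymptotics ht hcω x hid hz (hk0.mono fun k hk => zOf_sq ω c hk)
  constructor
  · have he : Tendsto (fun k : ℂ => Complex.exp (Complex.I * k * ((x - liouvilleY ω u x t : ℝ) : ℂ)))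
        (𝓝[≠] (Complex.I / 2)) (𝓝 (Complex.exp (-((x - liouvilleY ω u x t : ℝ) : ℂ) / 2))) := by
      have := ((hid.const_mul Complex.I).mul_const ((x - liouvilleY ω u x t : ℝ) : ℂ)).cexp
      rwa [show Complex.I * (Complex.I / 2) * ((x - liouvilleY ω u x t : ℝ) : ℂ)
        = -((x - liouvilleY ω u x t : ℝ) : ℂ) / 2 by
          linear_combination ((x - liouvilleY ω u x t : ℝ) : ℂ) / 2 * Complex.I_sq] at this
    have := (h1.mul he).const_mul (liouvilleFactor ω u x t)
    rw [one_mul] at this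
    -- The poles proportional to `t` cancel, leaving the exponent `ik (x - y)`, which is `-(x -
    -- y)/2` at `k = i/2`.
    refine this.congr' ?_
    filter_upwards [hzim, hlam] with k hk hl
    rw [formulaVr, if_pos hk]
    simp only
    rw [mul_right_comm, ← Complex.exp_add, mul_comm (Complex.exp _)]
    congr 3
    have hl4 : 4 * k ^ 2 + 1 = 4 * lam k := by rw [lam]; ring
    rw [phaseR, hl4]
    push_cast
    field_simp
    ring
  · have hlamO : (fun k => lam k ^ 2) =O[𝓝[≠] (Complex.I / 2)] fun k => (k - Complex.I / 2) ^ 2 := by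
      have : (fun k => (k - Complex.I / 2) ^ 2 * (k + Complex.I / 2) ^ 2)
          =O[𝓝[≠] (Complex.I / 2)] fun k => (k - Complex.I / 2) ^ 2 * 1 :=
        (isBigO_refl _ _).mul (((hid.add_const (Complex.I / 2)).pow 2).isBigO_one ℂ)
      simp only [mul_one] at this
      refine this.congr_left fun k => ?_
      rw [← mul_pow, lam]
      congr 1
      linear_combination (-1 / 4) * Complex.I_sq
    have h4 := ((h3.trans hlamO).add ((isBigO_refl (fun k : ℂ => (k - Complex.I / 2) ^ 2)
      (𝓝[≠] (Complex.I / 2))).const_mul_left (2 * (u x t : ℂ) / ω))).const_mul_left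
        ((√((momentum u x t + ω) / ω) : ℝ) : ℂ)
    refine h4.congr' ?_ EventuallyEq.rfl
    filter_upwards [hzim] with k hk
    rw [formulaVr, if_pos hk]
    simp only
    have e : Complex.exp (Complex.I * phaseR ω u x t k)
        * Complex.exp (-Complex.I * phaseR ω u x t k) = 1 := by
      rw [← Complex.exp_add, neg_mul, add_neg_cancel, Complex.exp_zero]
    -- The linear term of `λ` at `i/2` turns `(2u/ω) λ` into `(2iu/ω)(k - i/2)`.
    have hl : lam k = Complex.I * (k - Complex.I / 2) + (k - Complex.I / 2) ^ 2 := by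
      rw [lam]; linear_combination (1 / 4) * Complex.I_sq
    rw [aPlus, one_div_div, ← liouvilleFactor_sq (hu.positive x t ht), hl]
    linear_combination (-liouvilleFactor ω u x t ^ 2 * (2 * Complex.I * k *
      (jostMinus ω c u x t k * jostPlus ω u x t k / wronskian ω c u x t k))) * e

/-- The factor `s` in `√((m+ω)/ω) = s √((m+ω)/(c+ω))` completes `2iz` to `2izs`, the normalization
for which `φ₋ φ₊ / W` has leading term one. Since `λ = (z - z₀)(z + z₀)` and `2 z₀ = i/s`, the
linear coefficient is `2i(u - c)/(ω s)`. -/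
theorem IsStepSolution.left_expansion (hu : IsStepSolution ω c l u) (ht : 0 ≤ t)
    (hcω : 0 < c / ω) (x : ℝ) {z₀ : ℂ} (hz₀ : z₀ = Complex.I / 2 * ((√(ω / (c + ω)) : ℝ) : ℂ)) :
    Tendsto (fun z => (formulaVl ω c u x t z).2) (𝓝[≠] z₀)
      (𝓝 (liouvilleFactor ω u x t * (((((c + ω) / ω) ^ (1 / 4 : ℝ) : ℝ) : ℂ)⁻¹ *
        Complex.exp (-((√(ω / (c + ω)) * (liouvilleY ω u x t + wp ω c u x t) - x + c * t : ℝ) : ℂ)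
          / 2)))) ∧
    (fun z => (formulaVl ω c u x t z).1 * (formulaVl ω c u x t z).2
        - ((√((momentum u x t + ω) / (c + ω)) : ℝ) : ℂ) *
          (1 + 2 * Complex.I * (u x t - c) / ((ω * √((c + ω) / ω) : ℝ) : ℂ) * (z - z₀)))
      =O[𝓝[≠] z₀] fun z => (z - z₀) ^ 2 := by
  set s : ℝ := √((c + ω) / ω) with hs
  have hs0 : 0 < (c + ω) / ω := zero_lt_one.trans (one_lt_add_div hcω)
  have hsp : 0 < s := Real.sqrt_pos.2 hs0
  have hsC : (s : ℂ) ≠ 0 := by exact_mod_cast hsp.ne'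
  have hω := ne_zero_of_div_pos hcω
  have hωC : (ω : ℂ) ≠ 0 := by exact_mod_cast hω
  have hcωC : (c : ℂ) + ω ≠ 0 := by exact_mod_cast add_ne_zero_of_div_pos hcω
  have hid : Tendsto (fun z : ℂ => z) (𝓝[≠] z₀) (𝓝 z₀) :=
    tendsto_id.mono_left nhdsWithin_le_nhds
  have hz0 : z₀ ≠ 0 := hz₀ ▸ z₀_ne_zero hcω
  have hz0s : z₀ = Complex.I / 2 * (s : ℂ)⁻¹ := by
    rw [hz₀, sqrt_div_add_eq_inv, Complex.ofReal_inv]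
  have hz0sq : z₀ ^ 2 = -((ω / (4 * (c + ω)) : ℝ) : ℂ) := hz₀ ▸ z₀_sq hcω
  have hk : Tendsto (kOf ω c) (𝓝[≠] z₀) (𝓝 (Complex.I / 2)) := by
    rw [hz₀]; exact (tendsto_kOf hcω).mono_left nhdsWithin_le_nhds
  have hzz : ∀ᶠ z in 𝓝[≠] z₀, zOf ω c (kOf ω c z) = z := by
    rw [hz₀]; exact (eventually_zOf_kOf hcω).filter_mono nhdsWithin_le_nhds
  have hzim : ∀ᶠ z in 𝓝[≠] z₀, 0 < z.im :=
    ((Complex.continuous_im.tendsto _).comp hid).eventually_const_lt (by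
      rw [hz₀, Complex.im_mul_ofReal]; simpa using Real.sqrt_pos.2 (div_add_pos hcω))
  have hne : ∀ᶠ z in 𝓝[≠] z₀, z ^ 2 + ((ω / (4 * (c + ω)) : ℝ) : ℂ) ≠ 0 :=
    eventually_sq_ne hz0 hz0sq
  have hlam : ∀ᶠ z in 𝓝[≠] z₀, lam (kOf ω c z) = z ^ 2 + ((ω / (4 * (c + ω)) : ℝ) : ℂ) := by
    filter_upwards [hid.eventually_ne hz0] with z hz
    rw [lam, kOf_sq ω c hz]
    push_cast
    field_simp
    ring
  obtain ⟨-, h2, -, h3⟩ := hu.jost_asymptotics ht hcω x hk ((tendsto_zOf hcω).comp hk)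
    ((hk.eventually_ne (show Complex.I / 2 ≠ 0 by simp)).mono fun z hz => zOf_sq ω c hz)
  rw [← hs] at h2 h3
  constructor
  · have he : Tendsto (fun z : ℂ => Complex.exp (Complex.I * z * (((liouvilleY ω u x t
        + wp ω c u x t) - s * x + s * c * t : ℝ) : ℂ))) (𝓝[≠] z₀) (𝓝 (Complex.exp
        (-((√(ω / (c + ω)) * (liouvilleY ω u x t + wp ω c u x t) - x + c * t : ℝ) : ℂ) / 2))) := by
      have := ((hid.const_mul Complex.I).mul_const (((liouvilleY ω u x t
        + wp ω c u x t) - s * x + s * c * t : ℝ) : ℂ)).cexp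
      convert this using 3
      rw [hz0s, sqrt_div_add_eq_inv, ← hs]
      push_cast
      field_simp
      linear_combination (-((liouvilleY ω u x t : ℂ) + wp ω c u x t - s * x + s * c * t))
        * Complex.I_sq
    have := ((h2.mul he).const_mul
      (((((c + ω) / ω) ^ (1 / 4 : ℝ) : ℝ) : ℂ)⁻¹)).const_mul (liouvilleFactor ω u x t)
    rw [one_mul] at this
    refine this.congr' ?_
    filter_upwards [hzim, hzz, hlam, hne] with z h4 h5 h6 h7
    have hr : ((((c + ω) / ω) ^ (1 / 4 : ℝ) : ℝ) : ℂ) ≠ 0 := by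
      exact_mod_cast (Real.rpow_pos_of_pos hs0 _).ne'
    rw [formulaVl, if_pos h4]
    simp only
    rw [hs, minusFactor_mul_exp, ← hs, mul_assoc, mul_assoc, inv_mul_cancel_left₀ hr]
    congr 1
    rw [mul_left_comm, ← Complex.exp_add, h5]
    congr 2
    have hl4 : 4 * z ^ 2 + ((ω / (c + ω) : ℝ) : ℂ) = 4 * lam (kOf ω c z) := by
      rw [h6]; push_cast; field_simp
    rw [← h6] at h7
    rw [phaseL, ← hs, hl4]
    push_cast
    field_simp
    ring
  · have hfac : ∀ z, z ^ 2 + ((ω / (4 * (c + ω)) : ℝ) : ℂ) = (z - z₀) * (z + z₀) := fun z => by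
      linear_combination hz0sq
    have hlamO : (fun z => lam (kOf ω c z) ^ 2) =O[𝓝[≠] z₀] fun z => (z - z₀) ^ 2 := by
      have : (fun z => (z - z₀) ^ 2 * (z + z₀) ^ 2)
          =O[𝓝[≠] z₀] fun z => (z - z₀) ^ 2 * 1 :=
        (isBigO_refl _ _).mul (((hid.add_const z₀).pow 2).isBigO_one ℂ)
      simp only [mul_one] at this
      refine this.congr' (hlam.mono fun z hz => ?_) EventuallyEq.rfl
      simp only
      rw [hz, hfac, mul_pow]
    have h4 := ((h3.trans hlamO).add ((isBigO_refl (fun z : ℂ => (z - z₀) ^ 2)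
      (𝓝[≠] z₀)).const_mul_left (2 * ((u x t : ℂ) - c) / ω))).const_mul_left
        ((√((momentum u x t + ω) / (c + ω)) : ℝ) : ℂ)
    refine h4.congr' ?_ EventuallyEq.rfl
    filter_upwards [hzim, hzz, hlam] with z h5 h6 h7
    rw [formulaVl, if_pos h5]
    simp only
    have e : Complex.exp (-Complex.I * phaseL ω c u x t z)
        * Complex.exp (Complex.I * phaseL ω c u x t z) = 1 := by
      rw [← Complex.exp_add, neg_mul, neg_add_cancel, Complex.exp_zero]
    have hq : liouvilleFactor ω u x t ^ 2
        = ((√((momentum u x t + ω) / (c + ω)) : ℝ) : ℂ) * s := by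
      rw [liouvilleFactor_sq (hu.positive x t ht), ← Complex.ofReal_mul, hs,
        ← Real.sqrt_mul' _ hs0.le]
      congr 2
      have := add_ne_zero_of_div_pos hcω
      field_simp
    rw [aMinus, one_div_div, h6, h7, hfac, hz0s]
    push_cast
    set G := jostMinus ω c u x t (kOf ω c z) * jostPlus ω u x t (kOf ω c z)
      / wronskian ω c u x t (kOf ω c z) with hG
    have e2 : liouvilleFactor ω u x t * (2 * Complex.I * z / wronskian ω c u x t (kOf ω c z) *
          jostPlus ω u x t (kOf ω c z) * Complex.exp (-Complex.I * phaseL ω c u x t z)) *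
        (liouvilleFactor ω u x t * (jostMinus ω c u x t (kOf ω c z) *
          Complex.exp (Complex.I * phaseL ω c u x t z)))
        = ((√((momentum u x t + ω) / (c + ω)) : ℝ) : ℂ) * s * (2 * Complex.I * z * G) := by
      rw [← hq, hG]
      linear_combination (liouvilleFactor ω u x t ^ 2 * (2 * Complex.I * z *
        (jostMinus ω c u x t (kOf ω c z) * jostPlus ω u x t (kOf ω c z)
          / wronskian ω c u x t (kOf ω c z)))) * e
    rw [e2]
    field_simp
    ring

end CamassaHolm

/-! ### Assembly: values, expansions and parametric recovery of `u` -/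

theorem mainTheorem2 (ω c : ℝ) (hcω : 0 < c / ω) (l : ℕ) (u : ℝ → ℝ → ℝ)
    (hu : IsStepSolution ω c l u) (t : ℝ) (ht : 0 ≤ t) :
    -- the Liouville variable is an admissible parameter on the line
    (StrictMono (fun x => liouvilleY ω u x t) ∧
      Function.Bijective (fun x => liouvilleY ω u x t)) ∧
    ∀ x : ℝ,
      -- right problem: at and near `k = i/2`
      (ContinuousAt (Vr ω c u x t) (Complex.I / 2) ∧
        (Vr ω c u x t (Complex.I / 2)).2 ≠ 0 ∧
        (Vr ω c u x t (Complex.I / 2)).1 / (Vr ω c u x t (Complex.I / 2)).2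
          = ((Real.exp (x - liouvilleY ω u x t) : ℝ) : ℂ) ∧
        (fun k : ℂ => (Vr ω c u x t k).1 * (Vr ω c u x t k).2
            - ((√((momentum u x t + ω) / ω) : ℝ) : ℂ) *
              (1 + 2 * Complex.I / ω * u x t * (k - Complex.I / 2)))
          =O[𝓝 (Complex.I / 2)] (fun k : ℂ => (k - Complex.I / 2) ^ 2) ∧
        -- recovery of `x` and `u` from `V_r`
        (x : ℂ) = liouvilleY ω u x t
          + Complex.log ((Vr ω c u x t (Complex.I / 2)).1 / (Vr ω c u x t (Complex.I / 2)).2) ∧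
        (u x t : ℂ) = ω / (2 * Complex.I) *
          (deriv (fun k => (Vr ω c u x t k).1 * (Vr ω c u x t k).2) (Complex.I / 2)
            / ((Vr ω c u x t (Complex.I / 2)).1 * (Vr ω c u x t (Complex.I / 2)).2))) ∧
      -- left problem: at and near `z₀ = (i/2) √(ω/(c+ω))`
      (∀ z₀ : ℂ, z₀ = Complex.I / 2 * ((√(ω / (c + ω)) : ℝ) : ℂ) →
        ContinuousAt (Vl ω c u x t) z₀ ∧
        (Vl ω c u x t z₀).2 ≠ 0 ∧
        (Vl ω c u x t z₀).1 / (Vl ω c u x t z₀).2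
          = ((Real.exp (√(ω / (c + ω)) * (liouvilleY ω u x t + wp ω c u x t) - x + c * t) : ℝ) : ℂ)
            ∧
        (Vl ω c u x t z₀).1 / (Vl ω c u x t z₀).2
          = ((Real.exp (∫ r in Set.Iic x,
              (√((momentum u r t + ω) / (c + ω)) - 1)) : ℝ) : ℂ) ∧
        (fun z : ℂ => (Vl ω c u x t z).1 * (Vl ω c u x t z).2
            - ((√((momentum u x t + ω) / (c + ω)) : ℝ) : ℂ) *
              (1 + 2 * Complex.I * (u x t - c) / ((ω * √((c + ω) / ω) : ℝ) : ℂ) * (z - z₀)))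
          =O[𝓝 z₀] (fun z : ℂ => (z - z₀) ^ 2) ∧
        -- recovery of `x` and `u` from `V_l`
        (x : ℂ) = ((√(ω / (c + ω)) * (liouvilleY ω u x t + wp ω c u x t) + c * t : ℝ) : ℂ)
            - Complex.log ((Vl ω c u x t z₀).1 / (Vl ω c u x t z₀).2) ∧
        (u x t : ℂ) = c + ((ω * √((c + ω) / ω) : ℝ) : ℂ) / (2 * Complex.I) *
            (deriv (fun z => (Vl ω c u x t z).1 * (Vl ω c u x t z).2) z₀
              / ((Vl ω c u x t z₀).1 * (Vl ω c u x t z₀).2))) := by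
  have hω := ne_zero_of_div_pos hcω
  refine ⟨⟨hu.strictMono_liouvilleY ht hω, hu.bijective_liouvilleY ht hcω⟩, fun x => ⟨?_, ?_⟩⟩
  · have hp := hu.positive x t ht
    have hq : ((√((momentum u x t + ω) / ω) : ℝ) : ℂ) ≠ 0 := by
      exact_mod_cast (Real.sqrt_pos.2 hp).ne'
    have hlf : liouvilleFactor ω u x t ≠ 0 := fun h => hq (by rw [← liouvilleFactor_sq hp, h]; simp)
    obtain ⟨h1, h2⟩ := hu.right_expansion ht hcω x
    obtain ⟨h3, h4, h5, h6, h7⟩ := fillIn_expansion (S := {k | lam k = 0})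
      (show lam (Complex.I / 2) = 0 by rw [lam, div_pow, Complex.I_sq]; norm_num)
      (eventually_sq_ne (by simp) (by rw [div_pow, Complex.I_sq]; norm_num)) hq
      (mul_ne_zero hlf (Complex.exp_ne_zero _)) h1 h2
    -- The square of the second component is the leading coefficient of the product times `exp(-(x -
    -- y))`.
    have h8 : (Vr ω c u x t (Complex.I / 2)).1 / (Vr ω c u x t (Complex.I / 2)).2
        = ((Real.exp (x - liouvilleY ω u x t) : ℝ) : ℂ) := by
      rw [Vr, h5, mul_pow, liouvilleFactor_sq hp, div_mul_cancel_left₀ hq, ← Complex.exp_nat_mul,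
        ← Complex.exp_neg, Complex.ofReal_exp]
      congr 1
      push_cast
      ring
    refine ⟨h3, h4, h8, h6, ?_, ?_⟩
    · rw [h8, ← Complex.ofReal_log (Real.exp_pos _).le, Real.log_exp]
      push_cast
      ring
    · rw [Vr, h7]
      have : (ω : ℂ) ≠ 0 := by exact_mod_cast hω
      field_simp
  · intro z₀ hz₀
    have hp := hu.positive x t ht
    have hs := zero_lt_one.trans (one_lt_add_div hcω)
    have hcω' := add_ne_zero_of_div_pos hcω
    have hsC : ((√((c + ω) / ω) : ℝ) : ℂ) ≠ 0 := by exact_mod_cast (Real.sqrt_pos.2 hs).ne'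
    have hp' : 0 < (momentum u x t + ω) / (c + ω) := by
      rw [show (momentum u x t + ω) / (c + ω) = (momentum u x t + ω) / ω / ((c + ω) / ω) by
        field_simp]
      exact div_pos hp hs
    have hq : ((√((momentum u x t + ω) / (c + ω)) : ℝ) : ℂ) ≠ 0 := by
      exact_mod_cast (Real.sqrt_pos.2 hp').ne'
    have hlf2 : liouvilleFactor ω u x t ^ 2 = ((√((momentum u x t + ω) / (c + ω)) : ℝ) : ℂ)
        * ((√((c + ω) / ω) : ℝ) : ℂ) := by
      rw [liouvilleFactor_sq hp, ← Complex.ofReal_mul, ← Real.sqrt_mul' _ hs.le]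
      congr 2
      field_simp
    have hlf : liouvilleFactor ω u x t ≠ 0 := fun h => mul_ne_zero hq hsC (by
      rw [← hlf2, h]; simp)
    have hr : ((((c + ω) / ω) ^ (1 / 4 : ℝ) : ℝ) : ℂ) ≠ 0 := by
      exact_mod_cast (Real.rpow_pos_of_pos hs _).ne'
    have hz0 : z₀ ≠ 0 := hz₀ ▸ z₀_ne_zero hcω
    have hz0sq : z₀ ^ 2 = -((ω / (4 * (c + ω)) : ℝ) : ℂ) := hz₀ ▸ z₀_sq hcω
    obtain ⟨h1, h2⟩ := hu.left_expansion ht hcω x hz₀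
    obtain ⟨h3, h4, h5, h6, h7⟩ := fillIn_expansion
      (S := {z | z ^ 2 + ((ω / (4 * (c + ω)) : ℝ) : ℂ) = 0})
      (show z₀ ^ 2 + ((ω / (4 * (c + ω)) : ℝ) : ℂ) = 0 by rw [hz0sq, neg_add_cancel])
      (eventually_sq_ne hz0 hz0sq) hq
      (mul_ne_zero hlf (mul_ne_zero (inv_ne_zero hr) (Complex.exp_ne_zero _))) h1 h2
    -- The squared quarter power is `s`, which cancels the `s` in the squared Liouville factor.
    have h8 : (Vl ω c u x t z₀).1 / (Vl ω c u x t z₀).2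
        = ((Real.exp (√(ω / (c + ω)) * (liouvilleY ω u x t + wp ω c u x t) - x + c * t) : ℝ) : ℂ)
        := by
      rw [Vl, h5, mul_pow, mul_pow, inv_pow, rpow_quarter_sq hs.le, hlf2, mul_assoc,
        mul_inv_cancel_left₀ hsC, div_mul_cancel_left₀ hq, ← Complex.exp_nat_mul,
        ← Complex.exp_neg, Complex.ofReal_exp]
      congr 1
      push_cast
      ring
    refine ⟨h3, h4, h8, ?_, h6, ?_, ?_⟩
    · rw [h8, exponent_eq_integral hcω]
    · rw [h8, ← Complex.ofReal_log (Real.exp_pos _).le, Real.log_exp]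
      push_cast
      ring
    · rw [Vl, h7]
      have : (ω : ℂ) ≠ 0 := by exact_mod_cast hω
      push_cast
      field_simp
      ring
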